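/- **Setting.** All functions are complex valued. Let $T>0$, $\varepsilon>0$, $n\ge 1$, let $\Omega\subset\mathbb R^n$ be open and bounded, with boundary $\Gamma=\partial\Omega$ of class $C^\infty$ and lying on one side of $\Gamma$; $Q_T=(0,T)\times\Omega$, $\Sigma_T=(0,T)\times\Gamma$, $\nu$ is the outward unit normal and $\sigma$ the surface measure on $\Gamma$, and $(h*w)(t)=\int_0^t h(t-s)w(s)\,ds$. Boundary values of functions in $H^1(\Omega)$ are traces in $L^2(\Gamma)$. For a function $w$ in $H^1(0,T;V)$, $V$ a Hilbert space, $w(0)$ is the value at $0$ of its continuous representative. $H^{1,2}(Q_T)=H^1(0,T;L^2(\Omega))\cap L^2(0,T;H^2(\Omega))$. Put $$A=\sum_{i,j=1}^n D_{x_i}(a_{ij}D_{x_j}),\quad B=\sum_{i=1}^n b_iD_{x_i}+b_0,\quad A^*=\sum_{i,j=1}^n D_{x_j}(\overline{a_{ij}}\,D_{x_i}),$$ $$\Phi(w)=\int_\Omega \omega w\,dx,\qquad \mathcal M(w)=\int_\Omega\omega_1w\,dx+\int_\Gamma\omega_2w\,d\sigma,\qquad E_1(t)=\varepsilon^{-1}e^{-t/\varepsilon},$$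 $$E_0=[E_1*u_C+\varepsilon\phi_0E_1]\,u_A+u_B,\qquad \mathcal F(r)=(E_1*r)\,u_A+E_0 .$$ **Assumptions.** (C) For every $\tau\in[0,T]$ an operator $\mathcal W_\tau$ from $C([0,\tau])\cap BV([0,\tau])$ to itself is given, such that $\mathcal W_{\tau_2}(r|_{[0,\tau_2]})=\mathcal W_{\tau_1}(r)|_{[0,\tau_2]}$ if $0\le\tau_2\le\tau_1\le T$, and for some $L>0$, $\|\mathcal W_\tau(r_1)-\mathcal W_\tau(r_2)\|_{C([0,\tau])}\le L\|r_1-r_2\|_{C([0,\tau])}$ for all $\tau, r_1,r_2$. Write $\mathcal W=\mathcal W_T$. (H) $a_{ij}\in C^\infty(\overline\Omega)$, $b_i,b_0\in C^\infty(\Gamma)$, $\sum_i b_i\nu_i\ne0$ on $\Gamma$. For each $\theta\in[-\pi/2,\pi/2]$ the operator $e^{i\theta}D_t^2+A$ is properly elliptic in $\mathbb R\times\Omega$ and covered by $B$ on $\mathbb R\times\Gamma$. Covered means: for $x\in\Gamma$, $(\tau,\xi)\in(\mathbb R\times\mathbb R^n)\setminus\{0\}$ with $\xi$ tangent to $\Gamma$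 at $x$, and $\xi'\ne0$ normal to $\Gamma$ at $x$, the problem $-e^{i\theta}\tau^2y+\sum_{i,j}a_{ij}(x)(i\xi_i+\xi_i'D_t)(i\xi_j+\xi_j'D_t)y=0$ on $[0,\infty)$, $\sum_i b_i(x)(i\xi_i+\xi'_iD_t)y(0)=1$, has exactly one bounded solution. Moreover: $f\in H^1(0,T;L^2(\Omega))$; $u_0\in H^2(\Omega)$; $v_0:=Au_0+f(0,\cdot)\in H^1(\Omega)$; $q,u_A,u_B\in H^{5/4}(0,T;L^2(\Gamma))\cap H^1(0,T;H^{1/2}(\Gamma))$; $\omega\in H^2_0(\Omega)$; $g\in H^2(0,T)$; $\omega_1\in L^2(\Omega)$; $\omega_2\in L^2(\Gamma)$; $u_C\in C([0,T])\cap BV([0,T])$; $\phi_0\in\mathbb C$; $\Phi(Au_0)\ne0$; $\Phi(u_0)=g(0)$; $\Phi(v_0)=g'(0)$; and $Bu_0+q(0,\cdot)=\phi_0u_A(0,\cdot)+u_B(0,\cdot)-u_0|_\Gamma$. **Problem 2.** Find $(u,h)$ with $$\begin{cases}D_tu=Au+h*Au+f&\text{in }Q_T,\\ Bu+h*Bu+q=\mathcal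 F(\mathcal W(\mathcal M(u)))-u&\text{on }\Sigma_T,\\ u(0,\cdot)=u_0&\text{in }\Omega,\\ \Phi(u)=g&\text{in }[0,T].\end{cases}$$ **Problem 3.** Find $(v,h)$ with $$\begin{cases}D_tv=Av+h*Av+v^*-[(\psi_1,v)+h*(\psi_1,v)]\,z_0&\text{in }Q_T,\\ v(0,\cdot)=v_0&\text{in }\Omega,\\ Bv=-v+\Psi(v)-h*Bv+[(\psi_1,v)+h*(\psi_1,v)]\,z_1+v^*_\Gamma&\text{on }\Sigma_T,\\ h=h^*-(\psi_1,v)-h*(\psi_1,v)&\text{in }(0,T),\end{cases}$$ where $\chi=\Phi(Au_0)^{-1}$, $h^*(t)=\chi\,(g''(t)-\Phi(D_tf(t,\cdot)))$, $z_0=Au_0$, $z_1=Bu_0$, $v^*=D_tf+h^*z_0$, $\psi_1=\chi\,\overline{A^*\overline\omega}$, $(\psi_1,w)=\int_\Omega\psi_1w\,dx$, $\Psi(v)=D_t[\mathcal F(\mathcal W(\mathcal M(u_0+1*v)))]$, $v^*_\Gamma=-D_tq-h^*z_1$. **Proposition 2.1.** Under these assumptions: (a) If $(u,h)$ solves Problem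 2, with $u\in H^2(0,T;L^2(\Omega))\cap H^1(0,T;H^2(\Omega))$ and $h\in L^2(0,T)$, then, with $v:=D_tu$, one has $v\in H^{1,2}(Q_T)$, $h\in L^2(0,T)$, and $(v,h)$ solves Problem 3. (b) Conversely, if $(v,h)$ solves Problem 3, with $v\in H^{1,2}(Q_T)$ and $h\in L^2(0,T)$, then, with $u:=u_0+1*v$, one has $u\in H^2(0,T;L^2(\Omega))\cap H^1(0,T;H^2(\Omega))$, $h\in L^2(0,T)$, and $(u,h)$ solves Problem 2. -/

import Mathlib

open MeasureTheory Set Topology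

noncomputable section

namespace InverseControl

/-! ### Function spaces on `Ω` and on `Γ = ∂Ω` -/

/-- The Euclidean space `ℝⁿ`. -/
abbrev E (n : ℕ) := EuclideanSpace ℝ (Fin n)

variable {n : ℕ}

/-- Partial derivative `D_{x_i} φ` of a differentiable function. -/
def pderiv (i : Fin n) (φ : E n → ℂ) (x : E n) : ℂ :=
  fderiv ℝ φ x (EuclideanSpace.single i (1 : ℝ))

/-- `φ ∈ 𝒟(Ω) = C_c^∞(Ω)`. -/
def IsTest (Ω : Set (E n)) (φ : E n → ℂ) : Prop :=
  ContDiff ℝ (⊤ : ℕ∞) φ ∧ HasCompactSupport φ ∧ tsupport φ ⊆ Ω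

/-- The complex space `L²(Ω)`. -/
abbrev L2 (Ω : Set (E n)) := Lp ℂ 2 (volume.restrict Ω)

/-- The surface measure `σ` on `Γ = ∂Ω`: the `(n-1)`-dimensional Hausdorff measure (normalized so
that it is the Lebesgue measure on flat pieces) restricted to `Γ`. -/
def surf (Ω : Set (E n)) : Measure (E n) := (μHE[n - 1]).restrict (frontier Ω)

/-- The complex space `L²(Γ)`. -/
abbrev L2Γ (Ω : Set (E n)) := Lp ℂ 2 (surf Ω)

/-- The class in `L²(μ)` of a square integrable function. (Only used where the function is square
integrable; the value is `0` otherwise.) -/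
def toL2 (μ : Measure (E n)) (F : E n → ℂ) : Lp ℂ 2 μ :=
  open Classical in if hF : MemLp F 2 μ then hF.toLp F else 0

/-- `g = D_{x_i} w` in the sense of distributions in `Ω`. -/
def IsWeakPartial (Ω : Set (E n)) (i : Fin n) (w g : L2 Ω) : Prop :=
  ∀ φ : E n → ℂ, IsTest Ω φ →
    ∫ x in Ω, w x * pderiv i φ x = - ∫ x in Ω, g x * φ x

lemma memLp_of_test {Ω : Set (E n)} {φ : E n → ℂ} (hφ : Continuous φ)
    (hc : HasCompactSupport φ) : MemLp φ 2 (volume.restrict Ω) :=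
  (hφ.memLp_of_hasCompactSupport hc).restrict Ω

lemma continuous_pderiv {φ : E n → ℂ} (hφ : ContDiff ℝ (⊤ : ℕ∞) φ) (i : Fin n) :
    Continuous (pderiv i φ) :=
  (hφ.continuous_fderiv (by simp)).clm_apply continuous_const

lemma hasCompactSupport_pderiv {φ : E n → ℂ} (hφ : HasCompactSupport φ) (i : Fin n) :
    HasCompactSupport (pderiv i φ) :=
  hφ.fderiv_apply ℝ _

lemma integrable_mul_cc {Ω : Set (E n)} (w : L2 Ω) {φ : E n → ℂ} (hφ : Continuous φ)
    (hc : HasCompactSupport φ) : Integrable (fun x => w x * φ x) (volume.restrict Ω) :=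
  (Lp.memLp w).integrable_mul (memLp_of_test hφ hc)

lemma integral_add_cc {Ω : Set (E n)} (w w' : L2 Ω) {φ : E n → ℂ} (hφ : Continuous φ)
    (hc : HasCompactSupport φ) :
    ∫ x in Ω, (w + w') x * φ x = (∫ x in Ω, w x * φ x) + ∫ x in Ω, w' x * φ x := by
  rw [← integral_add (integrable_mul_cc w hφ hc) (integrable_mul_cc w' hφ hc)]
  refine integral_congr_ae ?_
  filter_upwards [Lp.coeFn_add w w'] with x hx
  rw [hx, Pi.add_apply, add_mul]

lemma integral_smul_cc {Ω : Set (E n)} (c : ℂ) (w : L2 Ω) (φ : E n → ℂ) :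
    ∫ x in Ω, (c • w) x * φ x = c * ∫ x in Ω, w x * φ x := by
  rw [← integral_const_mul]
  refine integral_congr_ae ?_
  filter_upwards [Lp.coeFn_smul c w] with x hx
  rw [hx, Pi.smul_apply, smul_eq_mul, mul_assoc]

lemma integral_star_cc {Ω : Set (E n)} (w : L2 Ω) (φ : E n → ℂ) :
    ∫ x in Ω, (star w) x * φ x = star (∫ x in Ω, w x * star (φ x)) := by
  rw [Complex.star_def, ← integral_conj]
  refine integral_congr_ae ?_
  filter_upwards [Lp.coeFn_star w] with x hx
  rw [hx, Pi.star_apply]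
  simp

lemma IsWeakPartial.add {Ω : Set (E n)} {i : Fin n} {w g w' g' : L2 Ω}
    (h : IsWeakPartial Ω i w g) (h' : IsWeakPartial Ω i w' g') :
    IsWeakPartial Ω i (w + w') (g + g') := by
  intro φ hφ
  rw [integral_add_cc w w' (continuous_pderiv hφ.1 i) (hasCompactSupport_pderiv hφ.2.1 i),
    integral_add_cc g g' hφ.1.continuous hφ.2.1, h φ hφ, h' φ hφ]
  ring

lemma IsWeakPartial.smul {Ω : Set (E n)} {i : Fin n} {w g : L2 Ω} (c : ℂ)
    (h : IsWeakPartial Ω i w g) : IsWeakPartial Ω i (c • w) (c • g) := by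
  intro φ hφ
  rw [integral_smul_cc, integral_smul_cc, h φ hφ]
  ring

lemma IsWeakPartial.zero {Ω : Set (E n)} {i : Fin n} : IsWeakPartial Ω i 0 0 := by
  intro φ hφ
  have h0 : ∀ ψ : E n → ℂ, ∫ x in Ω, (0 : L2 Ω) x * ψ x = 0 := by
    intro ψ
    have := integral_smul_cc (Ω := Ω) 0 0 ψ
    simpa using this
  rw [h0, h0, neg_zero]

lemma isTest_star {Ω : Set (E n)} {φ : E n → ℂ} (hφ : IsTest Ω φ) :
    IsTest Ω (fun x => star (φ x)) := by
  have hts : tsupport (fun x => star (φ x)) = tsupport φ := by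
    unfold tsupport
    congr 1
    ext x
    simp
  exact ⟨Complex.conjCLE.contDiff.comp hφ.1, by
    unfold HasCompactSupport
    rw [hts]
    exact hφ.2.1, hts ▸ hφ.2.2⟩

lemma pderiv_star {φ : E n → ℂ} (hφ : ContDiff ℝ (⊤ : ℕ∞) φ) (i : Fin n) (x : E n) :
    pderiv i (fun x => star (φ x)) x = star (pderiv i φ x) := by
  have hd : DifferentiableAt ℝ φ x := hφ.differentiable (by simp) x
  have h := (Complex.conjCLE.toContinuousLinearMap.hasFDerivAt.comp x hd.hasFDerivAt).fderiv
  have h' : fderiv ℝ (fun x => star (φ x)) x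
      = Complex.conjCLE.toContinuousLinearMap.comp (fderiv ℝ φ x) := h
  unfold pderiv
  rw [h']
  rfl

lemma IsWeakPartial.star {Ω : Set (E n)} {i : Fin n} {w g : L2 Ω}
    (h : IsWeakPartial Ω i w g) : IsWeakPartial Ω i (star w) (star g) := by
  intro φ hφ
  have := h _ (isTest_star hφ)
  rw [integral_star_cc, integral_star_cc, ← star_neg, ← this]
  simp only [pderiv_star hφ.1]

/-- The Sobolev space `H¹(Ω)`, as a subspace of a product of copies of `L²(Ω)`. Its elements are the families `(w, D_{x_1} w, …, D_{x_n} w)` of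
elements of `L²(Ω)` (entry `none` is `w`, entry `some i` is the distributional derivative
`D_{x_i} w`), with the Hilbert norm inherited from the product. -/
def H1Sub (Ω : Set (E n)) : Submodule ℂ (PiLp 2 (fun _ : Option (Fin n) => L2 Ω)) where
  carrier := {p | ∀ i, IsWeakPartial Ω i (p none) (p (some i))}
  add_mem' h h' i := (h i).add (h' i)
  zero_mem' _ := IsWeakPartial.zero
  smul_mem' c _ h i := (h i).smul c

/-- The Hilbert space `H¹(Ω)`. -/
abbrev H1 (Ω : Set (E n)) : Type := H1Sub Ω

/-- The function underlying an element of `H¹(Ω)`. -/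
def H1.fn {Ω : Set (E n)} (w : H1 Ω) : L2 Ω := w.1 none

/-- `D_{x_i} : H¹(Ω) → L²(Ω)`. -/
def H1.D {Ω : Set (E n)} (i : Fin n) (w : H1 Ω) : L2 Ω := w.1 (some i)

/-- The Sobolev space `H²(Ω)`, as a subspace of a product of copies of `H¹(Ω)`: the `w ∈ H¹(Ω)` all of whose derivatives `D_{x_i} w` lie in `H¹(Ω)`.
Its elements are the families `(w, D_{x_1} w, …, D_{x_n} w)` of elements of `H¹(Ω)`; the norm
is equivalent to `(∑_{|α| ≤ 2} ‖D^α w‖²)^{1/2}`. -/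
def H2Sub (Ω : Set (E n)) : Submodule ℂ (PiLp 2 (fun _ : Option (Fin n) => H1 Ω)) where
  carrier := {p | ∀ i, (p (some i)).fn = (p none).D i}
  add_mem' {p q} h h' i := by
    have e1 := h i
    have e2 := h' i
    exact congrArg₂ (· + ·) e1 e2
  zero_mem' _ := rfl
  smul_mem' c p h i := congrArg (c • ·) (h i)

/-- The Hilbert space `H²(Ω)`. -/
abbrev H2 (Ω : Set (E n)) : Type := H2Sub Ω

/-- The inclusion `H²(Ω) → H¹(Ω)`. -/
def H2.toH1 {Ω : Set (E n)} (w : H2 Ω) : H1 Ω := w.1 none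

/-- `D_{x_i} : H²(Ω) → H¹(Ω)`. -/
def H2.D {Ω : Set (E n)} (i : Fin n) (w : H2 Ω) : H1 Ω := w.1 (some i)

/-- The function underlying an element of `H²(Ω)`. -/
def H2.fn {Ω : Set (E n)} (w : H2 Ω) : L2 Ω := w.toH1.fn

/-- The complex conjugate of an element of `H¹(Ω)`. -/
def H1.conj {Ω : Set (E n)} (w : H1 Ω) : H1 Ω :=
  ⟨WithLp.toLp 2 (fun k => star (w.1 k)), fun i => (w.2 i).star⟩

/-- The complex conjugate of an element of `H²(Ω)`. -/
def H2.conj {Ω : Set (E n)} (w : H2 Ω) : H2 Ω :=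
  ⟨WithLp.toLp 2 (fun k => (w.1 k).conj), fun i => congrArg star (w.2 i)⟩

/-- `H²₀(Ω)`, the closure of `𝒟(Ω)` in `H²(Ω)`. -/
def H20 (Ω : Set (E n)) : Set (H2 Ω) :=
  closure {w | ∃ φ : E n → ℂ, IsTest Ω φ ∧ w.fn =ᵐ[volume.restrict Ω] φ}

/-- `γ` is a bounded linear extension to `H¹(Ω)` of the restriction map `φ ↦ φ|_Γ` defined for
`φ ∈ C^∞(Ω̄)`. -/
def IsTraceOp (Ω : Set (E n)) (γ : H1 Ω →L[ℂ] L2Γ Ω) : Prop :=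
  ∀ (φ : E n → ℂ) (w : H1 Ω), ContDiff ℝ (⊤ : ℕ∞) φ → w.fn =ᵐ[volume.restrict Ω] φ →
    γ w =ᵐ[surf Ω] φ

/-- The trace operator `w ↦ w|_Γ` from `H¹(Ω)` to `L²(Γ)`: the bounded linear extension of the
restriction map. For a bounded `Ω` with smooth boundary, lying on one side of it, the extension
exists by the classical trace theorem, and it is unique since `C^∞(Ω̄)` is dense in `H¹(Ω)`. -/
def trace (Ω : Set (E n)) : H1 Ω →L[ℂ] L2Γ Ω :=
  open Classical in if h : ∃ γ, IsTraceOp Ω γ then h.choose else 0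

/-- The square of the Gagliardo seminorm of `H^{1/2}(Γ)`; an element `w` of `L²(Γ)` lies in
`H^{1/2}(Γ)` if and only if it is finite (`Γ` has dimension `n - 1`, whence the exponent
`(n - 1) + 2 · (1/2) = n`). -/
def halfSeminormSq {Ω : Set (E n)} (w : L2Γ Ω) : ENNReal :=
  ∫⁻ x, ∫⁻ y, ‖w x - w y‖ₑ ^ 2 / ‖x - y‖ₑ ^ n ∂(surf Ω) ∂(surf Ω)

/-! ### Functions of time with values in a Hilbert space -/

section Time

variable {V : Type*} [NormedAddCommGroup V] [NormedSpace ℂ V]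

/-- Lebesgue measure on `(0, T)`. -/
def timeMeasure (T : ℝ) : Measure ℝ := volume.restrict (Ioo 0 T)

/-- `w ∈ L²(0, T; V)`. -/
def MemTimeL2 (T : ℝ) (w : ℝ → V) : Prop := MemLp w 2 (timeMeasure T)

/-- `w' ∈ L²(0, T; V)` is the derivative of `w` in the sense of `V`-valued distributions. -/
def IsTimeDeriv (T : ℝ) (w w' : ℝ → V) : Prop :=
  MemTimeL2 T w' ∧ ∀ φ : ℝ → ℝ, ContDiff ℝ (⊤ : ℕ∞) φ → HasCompactSupport φ → tsupport φ ⊆ Ioo 0 T →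
    ∫ t, ((deriv φ t : ℝ) : ℂ) • w t ∂(timeMeasure T)
      = - ∫ t, ((φ t : ℝ) : ℂ) • w' t ∂(timeMeasure T)

/-- `w ∈ H¹(0, T; V)`. -/
def MemTimeH1 (T : ℝ) (w : ℝ → V) : Prop := MemTimeL2 T w ∧ ∃ w', IsTimeDeriv T w w'

/-- The distributional derivative `D_t w` of `w ∈ H¹(0, T; V)` (unique up to equality almost
everywhere). -/
def timeDeriv (T : ℝ) (w : ℝ → V) : ℝ → V :=
  open Classical in if h : ∃ w', IsTimeDeriv T w w' then h.choose else 0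

/-- `w ∈ H²(0, T; V)`. -/
def MemTimeH2 (T : ℝ) (w : ℝ → V) : Prop := MemTimeH1 T w ∧ MemTimeH1 T (timeDeriv T w)

/-- `w ∈ H^{5/4}(0, T; V)`: `w ∈ H¹(0, T; V)` and `D_t w ∈ H^{1/4}(0, T; V)`, the latter space being
described by the Gagliardo seminorm. -/
def MemTimeH54 (T : ℝ) (w : ℝ → V) : Prop :=
  MemTimeH1 T w ∧
    (∫⁻ t in Ioo 0 T, ∫⁻ s in Ioo 0 t,
      ‖timeDeriv T w t - timeDeriv T w s‖ₑ ^ 2 / ENNReal.ofReal ((t - s) ^ (3 / 2 : ℝ))) < ⊤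

/-- The representative of `w` that is continuous on `[0, T]` (it exists for `w ∈ H¹(0, T; V)`, and is
unique on `[0, T]`). -/
def contRep (T : ℝ) (w : ℝ → V) : ℝ → V :=
  open Classical in
  if h : ∃ F : ℝ → V, ContinuousOn F (Icc 0 T) ∧ F =ᵐ[timeMeasure T] w then h.choose else 0

/-- The value `w(0)` of the continuous representative of `w`. -/
def initialValue (T : ℝ) (w : ℝ → V) : V := contRep T w 0

/-- The convolution `(h ∗ w)(t) = ∫₀ᵗ h(t - s) w(s) ds`. -/
def conv (h : ℝ → ℂ) (w : ℝ → V) (t : ℝ) : V := ∫ s in (0 : ℝ)..t, h (t - s) • w s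

end Time

/-- `w ∈ H¹(0, T; H^{1/2}(Γ))`. -/
def MemTimeH1Hhalf {Ω : Set (E n)} (T : ℝ) (w : ℝ → L2Γ Ω) : Prop :=
  MemTimeH1 T w ∧ (∫⁻ t in Ioo 0 T, halfSeminormSq (w t)) < ⊤ ∧
    (∫⁻ t in Ioo 0 T, halfSeminormSq (timeDeriv T w t)) < ⊤

/-- `f ∈ C([0, τ]) ∩ BV([0, τ])`. -/
def MemCBV (τ : ℝ) (f : ℝ → ℂ) : Prop :=
  ContinuousOn f (Icc 0 τ) ∧ BoundedVariationOn f (Icc 0 τ)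

/-- `v ∈ H^{1,2}(Q_T) = H¹(0, T; L²(Ω)) ∩ L²(0, T; H²(Ω))`. -/
def MemH12 {Ω : Set (E n)} (T : ℝ) (v : ℝ → H2 Ω) : Prop :=
  MemTimeH1 T (fun t => (v t).fn) ∧ MemTimeL2 T v

/-! ### Smooth domains, ellipticity and the covering condition -/

/-- `f ∈ C^∞(S)` for a closed set `S`: `f` is on `S` the restriction of a smooth function
on `ℝⁿ`. -/
def IsSmoothOn (f : E n → ℂ) (S : Set (E n)) : Prop := ∃ F : E n → ℂ, ContDiff ℝ (⊤ : ℕ∞) F ∧ EqOn f F S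

/-- `ρ` is a smooth function that defines `Ω` as `{ρ < 0}` near the point `x` of its boundary, with
nonvanishing gradient at `x`. -/
def IsDefiningAt (Ω : Set (E n)) (x : E n) (ρ : E n → ℝ) : Prop :=
  ContDiff ℝ (⊤ : ℕ∞) ρ ∧ gradient ρ x ≠ 0 ∧ ∀ᶠ y in 𝓝 x, y ∈ Ω ↔ ρ y < 0

/-- `Ω` is a bounded open set, with boundary of class `C^∞`, lying on one side of it. -/
def IsSmoothBoundedDomain (Ω : Set (E n)) : Prop :=
  IsOpen Ω ∧ Bornology.IsBounded Ω ∧ ∀ x ∈ frontier Ω, ∃ ρ, IsDefiningAt Ω x ρ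

/-- `ν` is the outward unit normal vector to `Γ` at `x`. -/
def IsOuterNormal (Ω : Set (E n)) (x ν : E n) : Prop :=
  ∃ ρ, IsDefiningAt Ω x ρ ∧ ν = ‖gradient ρ x‖⁻¹ • gradient ρ x

/-- The principal symbol, up to the sign, of `e^{iθ} D_t² + ∑ D_{x_i}(a_{ij} D_{x_j})`. -/
def symb (a : Fin n → Fin n → E n → ℂ) (θ : ℝ) (x : E n) (τ : ℂ) (ξ : Fin n → ℂ) : ℂ :=
  Complex.exp (θ * Complex.I) * τ ^ 2 + ∑ i, ∑ j, a i j x * ξ i * ξ j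

/-- The operator `e^{iθ} D_t² + ∑ D_{x_i}(a_{ij} D_{x_j})` is properly elliptic in `ℝ × Ω`: its
principal symbol has no nontrivial real zero, and along any two linearly independent real covectors
it has exactly one root (with multiplicity) in each of the open half-planes. -/
def IsProperlyElliptic (a : Fin n → Fin n → E n → ℂ) (θ : ℝ) (Ω : Set (E n)) : Prop :=
  ∀ x ∈ Ω,
    (∀ (τ : ℝ) (ξ : E n), (τ, ξ) ≠ 0 → symb a θ x τ (fun i => (ξ i : ℂ)) ≠ 0) ∧
    ∀ (τ τ' : ℝ) (ξ ξ' : E n), LinearIndependent ℝ ![(τ, ξ), (τ', ξ')] →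
      ∃ c z₁ z₂ : ℂ, 0 < z₁.im ∧ z₂.im < 0 ∧
        ∀ z : ℂ, symb a θ x (τ + z * τ') (fun i => ξ i + z * ξ' i) = c * (z - z₁) * (z - z₂)

/-- The first order operator `i α + β D_t` acting on functions of domain `[0, ∞)`. -/
def odeOp (α β : ℝ) (v : ℝ → ℂ) (t : ℝ) : ℂ :=
  Complex.I * α * v t + β * derivWithin v (Ici 0) t

/-- `v` is a bounded solution in `[0, ∞)` of the boundary ODE problem at the point `x`. -/
def IsBoundedOdeSol (a : Fin n → Fin n → E n → ℂ) (b : Fin n → E n → ℂ) (θ : ℝ) (x : E n)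
    (τ : ℝ) (ξ ξ' : E n) (v : ℝ → ℂ) : Prop :=
  ContDiffOn ℝ 2 v (Ici 0) ∧
  (∀ t ∈ Ici (0 : ℝ), - Complex.exp (θ * Complex.I) * τ ^ 2 * v t
    + ∑ i, ∑ j, a i j x * odeOp (ξ i) (ξ' i) (odeOp (ξ j) (ξ' j) v) t = 0) ∧
  ∑ i, b i x * odeOp (ξ i) (ξ' i) v 0 = 1 ∧
  ∃ M : ℝ, ∀ t ∈ Ici (0 : ℝ), ‖v t‖ ≤ M

/-- The operator `e^{iθ} D_t² + ∑ D_{x_i}(a_{ij} D_{x_j})` is covered by `B` in `ℝ × Γ`: for `x ∈ Γ`,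
`(τ, ξ) ≠ 0` with `ξ` tangent, and `ξ' ≠ 0` normal to `Γ` at `x`, the boundary ODE problem has
exactly one solution that is bounded in `[0, ∞)`. -/
def IsCovered (a : Fin n → Fin n → E n → ℂ) (b : Fin n → E n → ℂ) (θ : ℝ)
    (Ω : Set (E n)) : Prop :=
  ∀ x ∈ frontier Ω, ∀ ν, IsOuterNormal Ω x ν →
    ∀ (τ : ℝ) (ξ : E n), (τ, ξ) ≠ 0 → inner ℝ ξ ν = 0 → ∀ c : ℝ, c ≠ 0 →
      ∃ v, IsBoundedOdeSol a b θ x τ ξ (c • ν) v ∧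
        ∀ w, IsBoundedOdeSol a b θ x τ ξ (c • ν) w → EqOn w v (Ici 0)

/-! ### The data -/

/-- The data of the inverse control problem. Functions on `Q_T` (on `Σ_T`) are seen as functions of
`t` with values in `L²(Ω)` (in `L²(Γ)`); what they are outside `(0, T)` is irrelevant. `W τ` is the
memory operator `𝒲_τ`, acting on functions of domain `[0, τ]`. -/
structure Data (n : ℕ) where
  Ω : Set (E n)
  T : ℝ
  a : Fin n → Fin n → E n → ℂ
  b : Fin n → E n → ℂ
  b₀ : E n → ℂ
  f : ℝ → L2 Ω
  u₀ : H2 Ω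
  q : ℝ → L2Γ Ω
  ω : H2 Ω
  g : ℝ → ℂ
  ω₁ : L2 Ω
  ω₂ : L2Γ Ω
  uA : ℝ → L2Γ Ω
  uB : ℝ → L2Γ Ω
  uC : ℝ → ℂ
  φ₀ : ℂ
  ε : ℝ
  W : ℝ → (ℝ → ℂ) → ℝ → ℂ

/-- The operator `∑ D_{x_i}(c_{ij} D_{x_j})` from `H²(Ω)` to `L²(Ω)`, for smooth `c_{ij}`. -/
def divForm {Ω : Set (E n)} (c : Fin n → Fin n → E n → ℂ) (w : H2 Ω) : L2 Ω :=
  toL2 (volume.restrict Ω) fun x =>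
    ∑ i, ∑ j, (c i j x * ((w.D j).D i) x + pderiv i (c i j) x * ((w.D j).fn) x)

namespace Data

variable (P : Data n)

/-- `A = ∑ D_{x_i}(a_{ij} D_{x_j})`. -/
def A (w : H2 P.Ω) : L2 P.Ω := divForm P.a w

/-- `A* = ∑ D_{x_j}(conj(a_{ij}) D_{x_i})`. -/
def Astar (w : H2 P.Ω) : L2 P.Ω := divForm (fun i j x => star (P.a j i x)) w

/-- The trace on `Γ` of an element of `H²(Ω)`. -/
def tr (w : H2 P.Ω) : L2Γ P.Ω := trace P.Ω w.toH1

/-- `B w = ∑ b_i (D_{x_i} w)|_Γ + b_0 w|_Γ`. -/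
def B (w : H2 P.Ω) : L2Γ P.Ω :=
  toL2 (surf P.Ω) fun x => ∑ i, P.b i x * (trace P.Ω (w.D i)) x + P.b₀ x * (P.tr w) x

/-- `Φ(w) = ∫_Ω ω w dx`. -/
def Phi (w : L2 P.Ω) : ℂ := ∫ x in P.Ω, P.ω.fn x * w x

/-- `ℳ(w) = ∫_Ω ω₁ w dx + ∫_Γ ω₂ w dσ`. -/
def M (w : H2 P.Ω) : ℂ :=
  (∫ x in P.Ω, P.ω₁ x * w.fn x) + ∫ y, P.ω₂ y * (P.tr w) y ∂(surf P.Ω)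

/-- `E₁(t) = ε⁻¹ e^{-t/ε}`. -/
def E1 (t : ℝ) : ℂ := ((P.ε⁻¹ * Real.exp (-t / P.ε) : ℝ) : ℂ)

/-- `E₀(t, ·) = [(E₁ ∗ u_C)(t) + ε φ₀ E₁(t)] u_A(t, ·) + u_B(t, ·)`. -/
def E0 (t : ℝ) : L2Γ P.Ω :=
  (conv P.E1 P.uC t + (P.ε : ℂ) * P.φ₀ * P.E1 t) • P.uA t + P.uB t

/-- `ℱ(r)(t, ·) = (E₁ ∗ r)(t) u_A(t, ·) + E₀(t, ·)`. -/
def F (r : ℝ → ℂ) (t : ℝ) : L2Γ P.Ω := conv P.E1 r t • P.uA t + P.E0 t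

/-- `ℱ(𝒲(ℳ(u)))`; the operator `𝒲` is applied to the continuous representative of `ℳ(u)`. -/
def feedback (u : ℝ → H2 P.Ω) : ℝ → L2Γ P.Ω :=
  P.F (P.W P.T (contRep P.T fun t => P.M (u t)))

/-- `v₀ = A u₀ + f(0, ·)`. -/
def v₀ : L2 P.Ω := P.A P.u₀ + initialValue P.T P.f

/-- The standing assumptions on the data. -/
structure Admissible : Prop where
  T_pos : 0 < P.T
  ε_pos : 0 < P.ε
  W_maps : ∀ τ ∈ Icc 0 P.T, ∀ r, MemCBV τ r → MemCBV τ (P.W τ r)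
  W_causal : ∀ τ₁ τ₂ : ℝ, 0 ≤ τ₂ → τ₂ ≤ τ₁ → τ₁ ≤ P.T → ∀ r, MemCBV τ₁ r →
    EqOn (P.W τ₂ r) (P.W τ₁ r) (Icc 0 τ₂)
  W_lipschitz : ∃ L : ℝ, 0 < L ∧ ∀ τ ∈ Icc 0 P.T, ∀ r₁ r₂, MemCBV τ r₁ → MemCBV τ r₂ →
    ∀ K : ℝ, (∀ t ∈ Icc 0 τ, ‖r₁ t - r₂ t‖ ≤ K) →
      ∀ t ∈ Icc 0 τ, ‖P.W τ r₁ t - P.W τ r₂ t‖ ≤ L * K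
  domain : IsSmoothBoundedDomain P.Ω
  a_smooth : ∀ i j, IsSmoothOn (P.a i j) (closure P.Ω)
  b_smooth : ∀ i, IsSmoothOn (P.b i) (frontier P.Ω)
  b₀_smooth : IsSmoothOn P.b₀ (frontier P.Ω)
  b_normal : ∀ x ∈ frontier P.Ω, ∀ ν, IsOuterNormal P.Ω x ν → ∑ i, P.b i x * (ν i : ℂ) ≠ 0
  elliptic : ∀ θ ∈ Icc (-(Real.pi / 2)) (Real.pi / 2), IsProperlyElliptic P.a θ P.Ω
  covered : ∀ θ ∈ Icc (-(Real.pi / 2)) (Real.pi / 2), IsCovered P.a P.b θ P.Ω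
  f_mem : MemTimeH1 P.T P.f
  v₀_mem : ∃ w : H1 P.Ω, w.fn = P.v₀
  q_mem : MemTimeH54 P.T P.q ∧ MemTimeH1Hhalf P.T P.q
  ω_mem : P.ω ∈ H20 P.Ω
  g_mem : MemTimeH2 P.T P.g
  Phi_ne : P.Phi (P.A P.u₀) ≠ 0
  uA_mem : MemTimeH54 P.T P.uA ∧ MemTimeH1Hhalf P.T P.uA
  uB_mem : MemTimeH54 P.T P.uB ∧ MemTimeH1Hhalf P.T P.uB
  uC_mem : MemCBV P.T P.uC
  compat_g : P.Phi P.u₀.fn = initialValue P.T P.g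
  compat_g' : P.Phi P.v₀ = initialValue P.T (timeDeriv P.T P.g)
  compat_bdry : P.B P.u₀ + initialValue P.T P.q
    = P.φ₀ • initialValue P.T P.uA + initialValue P.T P.uB - P.tr P.u₀

/-! ### The two problems -/

/-- `u ∈ H²(0, T; L²(Ω)) ∩ H¹(0, T; H²(Ω))` and `h ∈ L²(0, T)`. -/
def Regular2 (u : ℝ → H2 P.Ω) (h : ℝ → ℂ) : Prop :=
  MemTimeH2 P.T (fun t => (u t).fn) ∧ MemTimeH1 P.T u ∧ MemTimeL2 P.T h

/-- `v ∈ H^{1,2}(Q_T)` and `h ∈ L²(0, T)`. -/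
def Regular3 (v : ℝ → H2 P.Ω) (h : ℝ → ℂ) : Prop :=
  MemH12 P.T v ∧ MemTimeL2 P.T h

/-- `(u, h)` solves the inverse control problem. -/
structure Solves2 (u : ℝ → H2 P.Ω) (h : ℝ → ℂ) : Prop where
  eq : ∀ᵐ t ∂(timeMeasure P.T), timeDeriv P.T (fun s => (u s).fn) t
    = P.A (u t) + conv h (fun s => P.A (u s)) t + P.f t
  bdry : ∀ᵐ t ∂(timeMeasure P.T), P.B (u t) + conv h (fun s => P.B (u s)) t + P.q t
    = P.feedback u t - P.tr (u t)
  init : initialValue P.T (fun t => (u t).fn) = P.u₀.fn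
  meas : ∀ᵐ t ∂(timeMeasure P.T), P.Phi (u t).fn = P.g t

/-- `χ = Φ(A u₀)⁻¹`. -/
def χ : ℂ := (P.Phi (P.A P.u₀))⁻¹

/-- `h*(t) = χ (g''(t) - Φ(D_t f(t, ·)))`. -/
def hstar (t : ℝ) : ℂ :=
  P.χ * (timeDeriv P.T (timeDeriv P.T P.g) t - P.Phi (timeDeriv P.T P.f t))

/-- `z₀ = A u₀`. -/
def z₀ : L2 P.Ω := P.A P.u₀

/-- `z₁ = B u₀`. -/
def z₁ : L2Γ P.Ω := P.B P.u₀

/-- `v*(t, ·) = D_t f(t, ·) + h*(t) z₀`. -/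
def vstar (t : ℝ) : L2 P.Ω := timeDeriv P.T P.f t + P.hstar t • P.z₀

/-- `ψ₁ = χ conj(A* conj(ω))`. -/
def ψ₁ : L2 P.Ω := P.χ • star (P.Astar P.ω.conj)

/-- `(ψ₁, w) = ∫_Ω ψ₁ w dx`. -/
def pair (w : L2 P.Ω) : ℂ := ∫ x in P.Ω, P.ψ₁ x * w x

/-- `(u₀ + 1 ∗ v)(t)`, the integral being taken in `H²(Ω)`. -/
def primitive (v : ℝ → H2 P.Ω) (t : ℝ) : H2 P.Ω := P.u₀ + conv (fun _ => 1) v t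

/-- `Ψ(v) = D_t [ℱ(𝒲(ℳ(u₀ + 1 ∗ v)))]`. -/
def Psi (v : ℝ → H2 P.Ω) : ℝ → L2Γ P.Ω := timeDeriv P.T (P.feedback (P.primitive v))

/-- `v*_Γ(t, ·) = - D_t q(t, ·) - h*(t) z₁`. -/
def vstarΓ (t : ℝ) : L2Γ P.Ω := - timeDeriv P.T P.q t - P.hstar t • P.z₁

/-- `(ψ₁, v(t, ·)) + (h ∗ (ψ₁, v))(t)`. -/
def memPair (v : ℝ → H2 P.Ω) (h : ℝ → ℂ) (t : ℝ) : ℂ :=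
  P.pair (v t).fn + conv h (fun s => P.pair (v s).fn) t

/-- `(v, h)` solves the differentiated problem. -/
structure Solves3 (v : ℝ → H2 P.Ω) (h : ℝ → ℂ) : Prop where
  eq : ∀ᵐ t ∂(timeMeasure P.T), timeDeriv P.T (fun s => (v s).fn) t
    = P.A (v t) + conv h (fun s => P.A (v s)) t + P.vstar t - P.memPair v h t • P.z₀
  init : initialValue P.T (fun t => (v t).fn) = P.v₀
  bdry : ∀ᵐ t ∂(timeMeasure P.T), P.B (v t)
    = - P.tr (v t) + P.Psi v t - conv h (fun s => P.B (v s)) t + P.memPair v h t • P.z₁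
      + P.vstarΓ t
  kernel : ∀ᵐ t ∂(timeMeasure P.T), h t = P.hstar t - P.memPair v h t

end Data

end InverseControl

end

noncomputable section

set_option linter.unusedSectionVars false

/-! A function in `H¹(0,T;V)` is, up to null sets, `c + ∫₀ᵗ w'`, where `c` is its initial value and
`w'` its weak derivative, both uniquely determined. Hence two such functions agree almost everywhere
as soon as their initial values and their derivatives agree. `HasTimePrim` records this normal form;
`MemTimeH1.hasTimePrim`, `HasTimePrim.timeDeriv_ae_eq` and `HasTimePrim.unique` pass between it and
the weak formulation.

Each equation of Problem 2 is an identity between functions of this kind, so it can be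
differentiated in one direction and integrated in the other. The constants of integration are
supplied by the initial and compatibility conditions. The only delicate term is the convolution,
since `h` is merely square integrable: `HasTimePrim.conv` puts the derivative on the other factor,
`D_t(h ∗ w) = h w(0) + h ∗ w'`, and this produces the terms `h A u₀` and `h B u₀`.

The kernel equation comes from applying `Φ` to the differentiated evolution equation, where `Φ(D_t
v) = g''`, and solving for `h`, which is possible because `Φ(A u₀) ≠ 0`. Green's formula against `ω
∈ H²₀(Ω)` (`integral_mul_divForm`) gives `χ Φ(A w) = (ψ₁, w)`. Substituting the resulting expression
for `h` into `h A u₀` and `h B u₀` yields exactly the sources `z₀` and `z₁` of Problem 3.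

For the feedback, `𝒲` returns functions that need not be weakly differentiable, but they enter only
through a convolution with the smooth kernel `E₁`. So the feedback is `H¹` in time, and its initial
value does not involve `𝒲` (`Admissible.hasTimePrim_feedback`).

All the spatial operators are bounded on the complete space `H²(Ω)`, so they commute with the time
integrals. Of `trace`, the argument uses only that it is linear and bounded. -/

namespace InverseControl

/-! ### Primitives in time and the product rule. -/

section TimePrimitive

variable {V : Type*} [NormedAddCommGroup V] [NormedSpace ℂ V]

/-- The primitive of an integrable function is absolutely continuous. -/
lemma absolutelyContinuous_primitive {w : ℝ → V} {a b : ℝ}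
    (hw : IntervalIntegrable w volume a b) :
    AbsolutelyContinuousOnInterval (fun t => ∫ s in a..t, w s) a b := by
  -- The increments of the primitive are dominated by those of the scalar primitive of the norm, for
  -- which absolute continuity is known.
  have h := hw.norm.absolutelyContinuousOnInterval_intervalIntegral (left_mem_uIcc)
  unfold AbsolutelyContinuousOnInterval at h ⊢
  refine squeeze_zero' (Filter.Eventually.of_forall fun _ => Finset.sum_nonneg fun _ _ => dist_nonneg)
    ?_ h
  rw [Filter.eventually_inf_principal]
  filter_upwards with E hE
  refine Finset.sum_le_sum fun i hi => ?_
  obtain ⟨h1, h2⟩ := hE.1 i hi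
  have i1 : IntervalIntegrable w volume a (E.2 i).1 :=
    hw.mono_set (uIcc_subset_uIcc left_mem_uIcc h1)
  have i2 : IntervalIntegrable w volume a (E.2 i).2 :=
    hw.mono_set (uIcc_subset_uIcc left_mem_uIcc h2)
  rw [dist_eq_norm, dist_eq_norm, intervalIntegral.integral_interval_sub_left i1 i2,
    intervalIntegral.integral_interval_sub_left i1.norm i2.norm]
  exact intervalIntegral.norm_integral_le_abs_integral_norm

lemma absolutelyContinuous_const_add {F : ℝ → V} {a b : ℝ} (c : V)
    (hF : AbsolutelyContinuousOnInterval F a b) :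
    AbsolutelyContinuousOnInterval (fun t => c + F t) a b := by
  unfold AbsolutelyContinuousOnInterval at hF ⊢
  simpa using hF

/-- The product rule for primitives, in integrated form. -/
lemma smul_primitive [CompleteSpace V] {T : ℝ} {p : ℝ → ℂ} {w : ℝ → V}
    (hp : IntervalIntegrable p volume 0 T) (hw : IntervalIntegrable w volume 0 T)
    (a : ℂ) (c : V) {t : ℝ} (ht : t ∈ uIcc 0 T) :
    (a + ∫ s in (0 : ℝ)..t, p s) • (c + ∫ s in (0 : ℝ)..t, w s) = a • c +
      ∫ s in (0 : ℝ)..t, (p s • (c + ∫ r in (0 : ℝ)..s, w r) + (a + ∫ r in (0 : ℝ)..s, p r) • w s) := by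
  have ap := absolutelyContinuous_const_add a (absolutelyContinuous_primitive hp)
  have aw := absolutelyContinuous_const_add c (absolutelyContinuous_primitive hw)
  have hi : IntervalIntegrable (fun s => p s • (c + ∫ r in (0 : ℝ)..s, w r)
      + (a + ∫ r in (0 : ℝ)..s, p r) • w s) volume 0 T :=
    (hp.smul_continuousOn aw.continuousOn).add (hw.continuousOn_smul ap.continuousOn)
  -- The product minus the primitive of its formal derivative is absolutely continuous with zero
  -- derivative almost everywhere, hence constant; its value is read off at `0`.
  obtain ⟨C, hC⟩ := ((ap.smul aw).sub (absolutelyContinuous_primitive hi)).const_of_ae_hasDerivAt_zero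
    (by
      filter_upwards [hp.ae_hasDerivAt_integral, hw.ae_hasDerivAt_integral,
        hi.ae_hasDerivAt_integral] with x h1 h2 h3 hx
      have e1 := (h1 hx 0 left_mem_uIcc).const_add a
      have e2 := (h2 hx 0 left_mem_uIcc).const_add c
      have e3 := (e1.smul e2).sub (h3 hx 0 left_mem_uIcc)
      convert e3 using 1
      abel)
  have h0 := hC 0 left_mem_uIcc
  have h1 := hC t ht
  simp only [Pi.sub_apply, Pi.smul_apply', intervalIntegral.integral_same, add_zero, sub_zero] at h0 h1
  rw [h0, ← h1]
  abel

instance (T : ℝ) : IsFiniteMeasure (timeMeasure T) := by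
  unfold timeMeasure; infer_instance

lemma MemTimeL2.integrable {T : ℝ} {w : ℝ → V} (hw : MemTimeL2 T w) :
    Integrable w (timeMeasure T) := MemLp.integrable (by norm_num) hw

lemma MemTimeL2.intervalIntegrable {T : ℝ} (hT : 0 < T) {w : ℝ → V} (hw : MemTimeL2 T w) :
    IntervalIntegrable w volume 0 T := by
  rw [intervalIntegrable_iff_integrableOn_Ioo_of_le hT.le]
  exact hw.integrable

lemma MemTimeL2.intervalIntegrable' {T : ℝ} (hT : 0 < T) {w : ℝ → V} (hw : MemTimeL2 T w)
    {t : ℝ} (ht : t ∈ Icc 0 T) : IntervalIntegrable w volume 0 t :=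
  (hw.intervalIntegrable hT).mono_set
    (uIcc_subset_uIcc left_mem_uIcc (by rwa [uIcc_of_le hT.le]))

lemma integral_timeMeasure {T : ℝ} (hT : 0 < T) (w : ℝ → V) :
    ∫ t, w t ∂(timeMeasure T) = ∫ t in (0 : ℝ)..T, w t := by
  rw [intervalIntegral.integral_of_le hT.le, integral_Ioc_eq_integral_Ioo]
  rfl

lemma ae_timeMeasure_mem (T : ℝ) : ∀ᵐ t ∂(timeMeasure T), t ∈ Ioo 0 T :=
  ae_restrict_mem measurableSet_Ioo

lemma memTimeL2_of_continuousOn {T : ℝ} {w : ℝ → V} (hw : ContinuousOn w (Icc 0 T)) :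
    MemTimeL2 T w := by
  obtain ⟨C, hC⟩ := isCompact_Icc.exists_bound_of_continuousOn hw
  refine MemLp.of_bound
    ((hw.mono Ioo_subset_Icc_self).aestronglyMeasurable measurableSet_Ioo) C ?_
  filter_upwards [ae_timeMeasure_mem T] with t ht using hC t (Ioo_subset_Icc_self ht)

lemma memTimeL2_congr {T : ℝ} {w w' : ℝ → V} (h : w =ᵐ[timeMeasure T] w') :
    MemTimeL2 T w ↔ MemTimeL2 T w' := memLp_congr_ae h

/-- A product of an element of `L²(0, T)` and a continuous function lies in `L²`. -/
lemma MemTimeL2.smul_continuousOn {T : ℝ} {p : ℝ → ℂ} {w : ℝ → V} (hp : MemTimeL2 T p)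
    (hw : ContinuousOn w (Icc 0 T)) : MemTimeL2 T (fun t => p t • w t) := by
  have h2 : MemLp w ⊤ (timeMeasure T) := by
    obtain ⟨C, hC⟩ := isCompact_Icc.exists_bound_of_continuousOn hw
    refine memLp_top_of_bound
      ((hw.mono Ioo_subset_Icc_self).aestronglyMeasurable measurableSet_Ioo) C ?_
    filter_upwards [ae_timeMeasure_mem T] with t ht using hC t (Ioo_subset_Icc_self ht)
  exact h2.smul (r := 2) hp

lemma MemTimeL2.continuousOn_smul {T : ℝ} {p : ℝ → ℂ} {w : ℝ → V} (hw : MemTimeL2 T w)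
    (hp : ContinuousOn p (Icc 0 T)) : MemTimeL2 T (fun t => p t • w t) := by
  have h2 : MemLp p ⊤ (timeMeasure T) := by
    obtain ⟨C, hC⟩ := isCompact_Icc.exists_bound_of_continuousOn hp
    refine memLp_top_of_bound
      ((hp.mono Ioo_subset_Icc_self).aestronglyMeasurable measurableSet_Ioo) C ?_
    filter_upwards [ae_timeMeasure_mem T] with t ht using hC t (Ioo_subset_Icc_self ht)
  exact MemLp.smul (r := 2) hw h2

/-- `w(t) = c + ∫₀ᵗ w'(s) ds` for almost every `t ∈ (0, T)`, with `w' ∈ L²(0, T; V)`. -/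
def HasTimePrim (T : ℝ) (w : ℝ → V) (c : V) (w' : ℝ → V) : Prop :=
  MemTimeL2 T w' ∧ w =ᵐ[timeMeasure T] fun t => c + ∫ s in (0 : ℝ)..t, w' s

lemma continuousOn_primitive_add {T : ℝ} (hT : 0 < T) {w' : ℝ → V} (hw : MemTimeL2 T w') (c : V) :
    ContinuousOn (fun t => c + ∫ s in (0 : ℝ)..t, w' s) (Icc 0 T) := by
  have := (absolutelyContinuous_const_add c
    (absolutelyContinuous_primitive (hw.intervalIntegrable hT))).continuousOn
  rwa [uIcc_of_le hT.le] at this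

namespace HasTimePrim

variable {T : ℝ} {w z w' z' : ℝ → V} {c d : V}

lemma memTimeL2 (hT : 0 < T) (h : HasTimePrim T w c w') : MemTimeL2 T w :=
  (memTimeL2_congr h.2).2 (memTimeL2_of_continuousOn (continuousOn_primitive_add hT h.1 c))

lemma congr (h : HasTimePrim T w c w') (hz : z =ᵐ[timeMeasure T] w) : HasTimePrim T z c w' :=
  ⟨h.1, hz.trans h.2⟩

lemma ae_integral_congr (h : w' =ᵐ[timeMeasure T] z') {t : ℝ} (ht : t ∈ Icc 0 T) :
    ∫ s in (0 : ℝ)..t, w' s = ∫ s in (0 : ℝ)..t, z' s := by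
  rw [intervalIntegral.integral_of_le ht.1, intervalIntegral.integral_of_le ht.1,
    integral_Ioc_eq_integral_Ioo, integral_Ioc_eq_integral_Ioo]
  exact integral_congr_ae (ae_restrict_of_ae_restrict_of_subset (Ioo_subset_Ioo_right ht.2) h)

lemma congr_deriv (h : HasTimePrim T w c w') (hz : w' =ᵐ[timeMeasure T] z') :
    HasTimePrim T w c z' := by
  refine ⟨(memTimeL2_congr hz).1 h.1, h.2.trans ?_⟩
  filter_upwards [ae_timeMeasure_mem T] with t ht
  rw [ae_integral_congr hz (Ioo_subset_Icc_self ht)]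

lemma add (hT : 0 < T) (h : HasTimePrim T w c w') (h' : HasTimePrim T z d z') :
    HasTimePrim T (fun t => w t + z t) (c + d) (fun t => w' t + z' t) := by
  refine ⟨MemLp.add h.1 h'.1, ?_⟩
  filter_upwards [h.2, h'.2, ae_timeMeasure_mem T] with t h1 h2 ht
  rw [h1, h2, intervalIntegral.integral_add (h.1.intervalIntegrable' hT (Ioo_subset_Icc_self ht))
    (h'.1.intervalIntegrable' hT (Ioo_subset_Icc_self ht))]
  abel

lemma map {U : Type*} [NormedAddCommGroup U] [NormedSpace ℂ U] [CompleteSpace U] [CompleteSpace V]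
    (hT : 0 < T) (L : V →L[ℂ] U) (h : HasTimePrim T w c w') :
    HasTimePrim T (fun t => L (w t)) (L c) (fun t => L (w' t)) := by
  refine ⟨L.comp_memLp' h.1, ?_⟩
  filter_upwards [h.2, ae_timeMeasure_mem T] with t h1 ht
  rw [h1, map_add]
  congr 1
  exact ((L.restrictScalars ℝ).intervalIntegral_comp_comm
    (h.1.intervalIntegrable' hT (Ioo_subset_Icc_self ht))).symm

/-- The product rule. -/
lemma smul [CompleteSpace V] (hT : 0 < T) {p p' : ℝ → ℂ} {a : ℂ} (hp : HasTimePrim T p a p')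
    (h : HasTimePrim T w c w') :
    HasTimePrim T (fun t => p t • w t) (a • c) (fun t => p' t • (c + ∫ s in (0 : ℝ)..t, w' s)
      + (a + ∫ s in (0 : ℝ)..t, p' s) • w' t) := by
  refine ⟨MemLp.add (hp.1.smul_continuousOn (continuousOn_primitive_add hT h.1 c))
    (h.1.continuousOn_smul (continuousOn_primitive_add hT hp.1 a)), ?_⟩
  filter_upwards [hp.2, h.2, ae_timeMeasure_mem T] with t h1 h2 ht
  rw [h1, h2, smul_primitive (hp.1.intervalIntegrable hT) (h.1.intervalIntegrable hT)]
  rw [uIcc_of_le hT.le]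
  exact Ioo_subset_Icc_self ht

lemma of_memTimeL2 (h : MemTimeL2 T w') (c : V) :
    HasTimePrim T (fun t => c + ∫ s in (0 : ℝ)..t, w' s) c w' := ⟨h, Filter.EventuallyEq.rfl⟩

lemma of_continuous_deriv [CompleteSpace V] (hw : ∀ t, HasDerivAt w (w' t) t) (hc : Continuous w') :
    HasTimePrim T w (w 0) w' := by
  refine ⟨memTimeL2_of_continuousOn hc.continuousOn, Filter.Eventually.of_forall fun t => ?_⟩
  simp only
  rw [intervalIntegral.integral_eq_sub_of_hasDerivAt (fun t _ => hw t) (hc.intervalIntegrable _ _)]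
  abel

/-- Integration by parts: the product rule is applied to `φ w` up to time `T`, and both boundary
terms vanish because `φ` is supported inside the open interval. -/
lemma isTimeDeriv [CompleteSpace V] (hT : 0 < T) (h : HasTimePrim T w c w') :
    IsTimeDeriv T w w' := by
  refine ⟨h.1, fun φ hφ hc hs => ?_⟩
  have hφ0 : φ 0 = 0 := image_eq_zero_of_notMem_tsupport fun h0 => (hs h0).1.false
  have hφT : φ T = 0 := image_eq_zero_of_notMem_tsupport fun h0 => (hs h0).2.false
  have hcd : Continuous (deriv φ) := hφ.continuous_deriv (by simp)
  have hp : HasTimePrim T (fun t => (φ t : ℂ)) (φ 0 : ℂ) (fun t => ((deriv φ t : ℝ) : ℂ)) :=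
    of_continuous_deriv (fun t => ((hφ.differentiable (by simp)).differentiableAt).hasDerivAt.ofReal_comp)
      (Complex.continuous_ofReal.comp hcd)
  have hφr : ∀ t : ℝ, (φ 0 : ℂ) + ∫ s in (0 : ℝ)..t, ((deriv φ s : ℝ) : ℂ) = φ t := by
    intro t
    rw [intervalIntegral.integral_eq_sub_of_hasDerivAt (f := fun t => (φ t : ℂ))
      (fun t _ => ((hφ.differentiable (by simp)).differentiableAt).hasDerivAt.ofReal_comp)
      ((Complex.continuous_ofReal.comp hcd).intervalIntegrable _ _)]
    ring
  have key := smul_primitive (hp.1.intervalIntegrable hT) (h.1.intervalIntegrable hT) (φ 0 : ℂ) c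
    (t := T) right_mem_uIcc
  simp only [hφr] at key
  rw [hφT, hφ0] at key
  simp only [Complex.ofReal_zero, zero_smul, zero_add] at key
  have i1 : Integrable (fun s => ((deriv φ s : ℝ) : ℂ) • (c + ∫ r in (0 : ℝ)..s, w' r))
      (timeMeasure T) :=
    (hp.1.smul_continuousOn (continuousOn_primitive_add hT h.1 c)).integrable
  have i2 : Integrable (fun s => (φ s : ℂ) • w' s) (timeMeasure T) :=
    (h.1.continuousOn_smul (p := fun s => (φ s : ℂ))
      (Complex.continuous_ofReal.comp hφ.continuous).continuousOn).integrable
  rw [← integral_timeMeasure hT, integral_add i1 i2] at key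
  rw [← sub_eq_zero, sub_neg_eq_add, key]
  congr 1
  refine integral_congr_ae ?_
  filter_upwards [h.2] with t ht
  rw [ht]

lemma memTimeH1 [CompleteSpace V] (hT : 0 < T) (h : HasTimePrim T w c w') : MemTimeH1 T w :=
  ⟨h.memTimeL2 hT, w', h.isTimeDeriv hT⟩

/-- `contRep` is picked by choice. Continuous functions that agree almost everywhere on the open
interval agree at each of its points, and then by density at the endpoints, so the choice does not
matter on `[0, T]`. The endpoint `0` is what makes `initialValue` computable. -/
lemma contRep_eq (hT : 0 < T) (h : HasTimePrim T w c w') :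
    EqOn (contRep T w) (fun t => c + ∫ s in (0 : ℝ)..t, w' s) (Icc 0 T) := by
  have hc := continuousOn_primitive_add hT h.1 c
  have hex : ∃ F : ℝ → V, ContinuousOn F (Icc 0 T) ∧ F =ᵐ[timeMeasure T] w := ⟨_, hc, h.2.symm⟩
  have hr : contRep T w = hex.choose := by simp only [contRep, dif_pos hex]
  rw [hr]
  obtain ⟨h1, h2⟩ := hex.choose_spec
  have h3 : EqOn hex.choose (fun t => c + ∫ s in (0 : ℝ)..t, w' s) (Ioo 0 T) :=
    Measure.eqOn_open_of_ae_eq (h2.trans h.2) isOpen_Ioo (h1.mono Ioo_subset_Icc_self)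
      (hc.mono Ioo_subset_Icc_self)
  exact h3.of_subset_closure h1 hc Ioo_subset_Icc_self (by rw [closure_Ioo hT.ne])

lemma initialValue_eq (hT : 0 < T) (h : HasTimePrim T w c w') : initialValue T w = c := by
  unfold initialValue
  rw [h.contRep_eq hT (left_mem_Icc.2 hT.le)]
  simp

end HasTimePrim

end TimePrimitive

/-! ### Weak derivatives in time are derivatives of primitives. -/

section WeakTimeDerivative

variable {V : Type*} [NormedAddCommGroup V] [NormedSpace ℂ V]

/-- The witness is the primitive started at the leftmost point of the support; the zero mean is what
makes it vanish again to the right of the support. -/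
lemma exists_test_of_integral_eq_zero {T : ℝ} {ψ : ℝ → ℝ} (hψ : ContDiff ℝ (⊤ : ℕ∞) ψ)
    (hc : HasCompactSupport ψ) (hs : tsupport ψ ⊆ Ioo 0 T) (h0 : ∫ t, ψ t = 0) :
    ∃ φ : ℝ → ℝ, ContDiff ℝ (⊤ : ℕ∞) φ ∧ HasCompactSupport φ ∧ tsupport φ ⊆ Ioo 0 T ∧
      deriv φ = ψ := by
  rcases (tsupport ψ).eq_empty_or_nonempty with he | hne
  · rw [tsupport_eq_empty_iff] at he
    refine ⟨0, contDiff_const, HasCompactSupport.zero, by simp, ?_⟩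
    rw [he]
    ext t
    simp
  obtain ⟨a, haK, ha⟩ := hc.isCompact.exists_isLeast hne
  obtain ⟨b, hbK, hb⟩ := hc.isCompact.exists_isGreatest hne
  have hz : ∀ t, t ∉ Icc a b → ψ t = 0 := fun t ht =>
    image_eq_zero_of_notMem_tsupport fun hm => ht ⟨ha hm, hb hm⟩
  have hψc := hψ.continuous
  have hd : ∀ t, HasDerivAt (fun t => ∫ s in a..t, ψ s) (ψ t) t := fun t =>
    hψc.integral_hasStrictDerivAt a t |>.hasDerivAt
  have hde : deriv (fun t => ∫ s in a..t, ψ s) = ψ := funext fun t => (hd t).deriv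
  have hsupp : tsupport (fun t => ∫ s in a..t, ψ s) ⊆ Icc a b := by
    refine closure_minimal (fun t ht => ?_) isClosed_Icc
    by_contra hn
    refine ht ?_
    rw [mem_Icc, not_and_or, not_le, not_le] at hn
    rcases hn with h | h
    · refine intervalIntegral.integral_zero_ae (Filter.Eventually.of_forall fun s hs => ?_)
      rw [uIoc_of_ge h.le] at hs
      rcases hs.2.lt_or_eq with h' | h'
      · exact hz s fun hm => absurd hm.1 (not_le.2 h')
      -- The endpoint `a` belongs to the closed support, so `hz` says nothing there; `ψ a` vanishes
      -- as a limit of zeros from the left.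
      · rw [h']
        have : Filter.Tendsto ψ (𝓝[<] a) (𝓝 (ψ a)) := hψc.continuousWithinAt
        have h2 : Filter.Tendsto ψ (𝓝[<] a) (𝓝 0) := by
          refine tendsto_const_nhds.congr' ?_
          filter_upwards [self_mem_nhdsWithin] with s hs
          exact (hz s fun hm => absurd hm.1 (not_le.2 hs)).symm
        exact tendsto_nhds_unique this h2
    · change ∫ s in a..t, ψ s = 0
      rw [← h0]
      have hab : a ≤ b := ha hbK
      rw [intervalIntegral.integral_of_le (hab.trans h.le), ← integral_Icc_eq_integral_Ioc]
      exact setIntegral_eq_integral_of_forall_compl_eq_zero fun s hs =>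
        hz s fun hm => hs ⟨hm.1, hm.2.trans h.le⟩
  refine ⟨fun t => ∫ s in a..t, ψ s, ?_, ?_, ?_, hde⟩
  · rw [contDiff_infty_iff_deriv, hde]
    exact ⟨fun t => (hd t).differentiableAt, hψ⟩
  · exact isCompact_Icc.of_isClosed_subset (isClosed_tsupport _) hsupp
  · exact hsupp.trans fun t ht => ⟨(hs haK).1.trans_le ht.1, ht.2.trans_lt (hs hbK).2⟩

lemma exists_test_integral_eq_one {T : ℝ} (hT : 0 < T) :
    ∃ φ : ℝ → ℝ, ContDiff ℝ (⊤ : ℕ∞) φ ∧ HasCompactSupport φ ∧ tsupport φ ⊆ Ioo 0 T ∧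
      ∫ t, φ t = 1 := by
  let f : ContDiffBump (T / 2) := ⟨T / 8, T / 4, by positivity, by linarith⟩
  refine ⟨f.normed volume, f.contDiff_normed, f.hasCompactSupport_normed, ?_, f.integral_normed⟩
  rw [f.tsupport_normed_eq, Real.closedBall_eq_Icc]
  intro t ht
  have h1 : T / 2 - T / 4 ≤ t := ht.1
  have h2 : t ≤ T / 2 + T / 4 := ht.2
  exact ⟨by linarith, by linarith⟩

/-- The du Bois-Reymond lemma. -/
lemma exists_ae_eq_const [CompleteSpace V] {T : ℝ} (hT : 0 < T) {w : ℝ → V} (hw : MemTimeL2 T w)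
    (h : ∀ φ : ℝ → ℝ, ContDiff ℝ (⊤ : ℕ∞) φ → HasCompactSupport φ → tsupport φ ⊆ Ioo 0 T →
      ∫ t, ((deriv φ t : ℝ) : ℂ) • w t ∂(timeMeasure T) = 0) :
    ∃ c, w =ᵐ[timeMeasure T] fun _ => c := by
  obtain ⟨ψ₀, h1, h2, h3, h4⟩ := exists_test_integral_eq_one hT
  -- As `ψ₀` has integral one, this weighted mean is the only possible value of the constant.
  set c := ∫ t, ((ψ₀ t : ℝ) : ℂ) • w t ∂(timeMeasure T) with hc
  have hint : ∀ {ψ : ℝ → ℝ} {z : ℝ → V}, Continuous ψ → MemTimeL2 T z →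
      Integrable (fun t => ((ψ t : ℝ) : ℂ) • z t) (timeMeasure T) := fun hψ hz =>
    (hz.continuousOn_smul (Complex.continuous_ofReal.comp hψ).continuousOn).integrable
  have hconst : MemTimeL2 T (fun _ => c) := memTimeL2_of_continuousOn continuousOn_const
  refine ⟨c, ?_⟩
  have key := isOpen_Ioo.ae_eq_zero_of_integral_contDiff_smul_eq_zero (U := Ioo 0 T)
    (f := fun t => w t - c) (μ := volume) ?_ ?_
  · rw [Filter.EventuallyEq, timeMeasure, ae_restrict_iff' measurableSet_Ioo]
    filter_upwards [key] with t ht hm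
    exact sub_eq_zero.1 (ht hm)
  · exact IntegrableOn.locallyIntegrableOn (hw.integrable.sub hconst.integrable)
  · intro ψ hψ hψc hψs
    have e1 : ∫ t, ψ t • (w t - c) = ∫ t, ((ψ t : ℝ) : ℂ) • (w t - c) ∂(timeMeasure T) := by
      rw [timeMeasure, setIntegral_eq_integral_of_forall_compl_eq_zero]
      · rfl
      · intro t ht
        have : ψ t = 0 := image_eq_zero_of_notMem_tsupport fun hm => ht (hψs hm)
        simp [this]
    have e2 : ∫ t, ((ψ t : ℝ) : ℂ) ∂(timeMeasure T) = ((∫ t, ψ t : ℝ) : ℂ) := by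
      rw [integral_complex_ofReal, timeMeasure, setIntegral_eq_integral_of_forall_compl_eq_zero]
      · intro t ht
        exact image_eq_zero_of_notMem_tsupport fun hm => ht (hψs hm)
    set m : ℝ := ∫ t, ψ t with hm
    -- Subtracting `m ψ₀` removes the mean, so the result is the derivative of a test function and
    -- the hypothesis applies to it.
    have hη : ContDiff ℝ (⊤ : ℕ∞) (fun t => ψ t - m * ψ₀ t) := hψ.sub (contDiff_const.mul h1)
    obtain ⟨φ, p1, p2, p3, p4⟩ := exists_test_of_integral_eq_zero (T := T) hη
      (hψc.sub (h2.mul_left (f := fun _ => m)))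
      ((tsupport_sub ψ (fun t => m * ψ₀ t)).trans (union_subset hψs
        ((tsupport_mul_subset_right (f := fun _ => m)).trans h3)))
      (by
        rw [integral_sub (hψ.continuous.integrable_of_hasCompactSupport hψc)
          ((h1.continuous.integrable_of_hasCompactSupport h2).const_mul m), integral_const_mul, h4]
        simp [hm])
    have e3 := h φ p1 p2 p3
    rw [p4] at e3
    have e4 : ∫ t, ((ψ t : ℝ) : ℂ) • w t ∂(timeMeasure T) = (m : ℂ) • c := by
      have i2 : Integrable (fun t => (m : ℂ) • ((ψ₀ t : ℝ) : ℂ) • w t) (timeMeasure T) :=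
        (hint h1.continuous hw).smul (m : ℂ)
      rw [hc, ← integral_smul, ← sub_eq_zero, ← integral_sub (hint hψ.continuous hw) i2, ← e3]
      refine integral_congr_ae (Filter.Eventually.of_forall fun t => ?_)
      simp only [Complex.ofReal_sub, Complex.ofReal_mul, sub_smul, mul_smul]
    rw [e1]
    simp only [smul_sub]
    rw [integral_sub (hint hψ.continuous hw) (hint hψ.continuous hconst), e4, integral_smul_const, e2,
      sub_self]

/-- The difference between `w` and the primitive of `w'` has zero weak derivative, so du
Bois-Reymond makes it a constant. -/
lemma IsTimeDeriv.hasTimePrim [CompleteSpace V] {T : ℝ} (hT : 0 < T) {w w' : ℝ → V}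
    (hw : MemTimeL2 T w) (h : IsTimeDeriv T w w') : ∃ c, HasTimePrim T w c w' := by
  have hz := HasTimePrim.of_memTimeL2 h.1 (0 : V)
  have hzL := hz.memTimeL2 hT
  obtain ⟨c, hc⟩ := exists_ae_eq_const hT (w := fun t => w t - (0 + ∫ s in (0 : ℝ)..t, w' s))
    (MemLp.sub hw hzL) (by
      intro φ h1 h2 h3
      have hcd : ContinuousOn (fun t => ((deriv φ t : ℝ) : ℂ)) (Icc 0 T) :=
        (Complex.continuous_ofReal.comp (h1.continuous_deriv (by simp))).continuousOn
      simp only [smul_sub]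
      rw [integral_sub (hw.continuousOn_smul hcd).integrable (hzL.continuousOn_smul hcd).integrable,
        h.2 φ h1 h2 h3, (hz.isTimeDeriv hT).2 φ h1 h2 h3, sub_self])
  refine ⟨c, h.1, ?_⟩
  filter_upwards [hc] with t ht
  rw [← ht]
  abel

namespace HasTimePrim

variable [CompleteSpace V] {T : ℝ} {w z w' z' : ℝ → V} {c d : V}

/-- The two primitives coincide on `[0, T]`, so their densities agree by Lebesgue differentiation.
This makes the chosen `timeDeriv` independent of the choice up to null sets. -/
lemma deriv_unique (hT : 0 < T) (h : HasTimePrim T w c w') (h' : HasTimePrim T w d z') :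
    w' =ᵐ[timeMeasure T] z' := by
  have h0 : c = d := by rw [← h.initialValue_eq hT, h'.initialValue_eq hT]
  subst h0
  have he : ∀ t ∈ Icc 0 T, ∫ s in (0 : ℝ)..t, w' s = ∫ s in (0 : ℝ)..t, z' s := fun t ht =>
    add_left_cancel ((h.contRep_eq hT ht).symm.trans (h'.contRep_eq hT ht))
  have hu : uIcc 0 T = Icc 0 T := uIcc_of_le hT.le
  rw [Filter.EventuallyEq, timeMeasure, ae_restrict_iff' measurableSet_Ioo]
  filter_upwards [(h.1.intervalIntegrable hT).ae_hasDerivAt_integral,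
    (h'.1.intervalIntegrable hT).ae_hasDerivAt_integral] with t h1 h2 ht
  have htu : t ∈ uIcc 0 T := hu ▸ Ioo_subset_Icc_self ht
  refine (h1 htu 0 left_mem_uIcc).unique ((h2 htu 0 left_mem_uIcc).congr_of_eventuallyEq ?_)
  filter_upwards [isOpen_Ioo.mem_nhds ht] with s hs using he s (Ioo_subset_Icc_self hs)

lemma timeDeriv_ae_eq (hT : 0 < T) (h : HasTimePrim T w c w') :
    timeDeriv T w =ᵐ[timeMeasure T] w' := by
  have hex : ∃ w', IsTimeDeriv T w w' := ⟨w', h.isTimeDeriv hT⟩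
  have hr : timeDeriv T w = hex.choose := by simp only [timeDeriv, dif_pos hex]
  rw [hr]
  obtain ⟨d, hd⟩ := hex.choose_spec.hasTimePrim hT (h.memTimeL2 hT)
  exact hd.deriv_unique hT h

lemma unique (h : HasTimePrim T w c w') (h' : HasTimePrim T z c z')
    (he : w' =ᵐ[timeMeasure T] z') : w =ᵐ[timeMeasure T] z :=
  (h.congr_deriv he).2.trans h'.2.symm

end HasTimePrim

lemma MemTimeH1.hasTimePrim [CompleteSpace V] {T : ℝ} (hT : 0 < T) {w : ℝ → V}
    (h : MemTimeH1 T w) : HasTimePrim T w (initialValue T w) (timeDeriv T w) := by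
  obtain ⟨h1, w', h2⟩ := h
  obtain ⟨c, hc⟩ := h2.hasTimePrim hT h1
  rw [hc.initialValue_eq hT]
  exact hc.congr_deriv (hc.timeDeriv_ae_eq hT).symm

end WeakTimeDerivative

/-! ### Convolution in time with a square integrable kernel. -/

section Convolution

variable {V : Type*} [NormedAddCommGroup V] [NormedSpace ℂ V] {T : ℝ} {h : ℝ → ℂ} {w : ℝ → V}

lemma conv_congr {w' : ℝ → V} (hw : w =ᵐ[timeMeasure T] w') {t : ℝ} (ht : t ∈ Icc 0 T) :
    conv h w t = conv h w' t := by
  refine HasTimePrim.ae_integral_congr (T := T) ?_ ht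
  filter_upwards [hw] with s hs
  rw [hs]

lemma conv_eq_swap (h : ℝ → ℂ) (w : ℝ → V) (t : ℝ) :
    conv h w t = ∫ s in (0 : ℝ)..t, h s • w (t - s) := by
  have := intervalIntegral.integral_comp_sub_left (a := 0) (b := t) (fun s => h s • w (t - s)) t
  simp only [sub_sub_cancel, sub_self, sub_zero] at this
  exact this

lemma conv_comm (h k : ℝ → ℂ) (t : ℝ) : conv h k t = conv k h t := by
  rw [conv_eq_swap]
  simp only [conv, smul_eq_mul, mul_comm]

lemma MemTimeL2.memLp_indicator (hw : MemTimeL2 T w) :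
    MemLp ((Ioo 0 T).indicator w) 2 volume :=
  (memLp_indicator_iff_restrict measurableSet_Ioo).2 hw

lemma MemTimeL2.integrable_indicator (hw : MemTimeL2 T w) :
    Integrable ((Ioo 0 T).indicator w) volume :=
  (integrable_indicator_iff measurableSet_Ioo).2 hw.integrable

/-- The convolution as an integral over the real line. -/
lemma conv_eq_integral {t : ℝ} (ht : t ∈ Icc 0 T) :
    conv h w t = ∫ s, (Ioo 0 T).indicator h s • (Ioo 0 T).indicator w (t - s) := by
  rw [conv_eq_swap, intervalIntegral.integral_of_le ht.1, integral_Ioc_eq_integral_Ioo]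
  refine Eq.trans (setIntegral_congr_fun measurableSet_Ioo fun s hs => ?_)
    (setIntegral_eq_integral_of_forall_compl_eq_zero (s := Ioo 0 t) fun s hs => ?_)
  · have h1 : s ∈ Ioo 0 T := ⟨hs.1, hs.2.trans_le ht.2⟩
    have h2 : t - s ∈ Ioo 0 T := ⟨by linarith [hs.2], by linarith [hs.1, ht.2]⟩
    simp only [indicator_of_mem h1, indicator_of_mem h2]
  · by_cases h1 : s ∈ Ioo 0 T
    · have h2 : t - s ∉ Ioo 0 T := fun h2 => hs ⟨h1.1, by linarith [h2.1]⟩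
      rw [indicator_of_notMem h2, smul_zero]
    · rw [indicator_of_notMem h1, zero_smul]

lemma integrable_conv_integrand (hh : MemTimeL2 T h) (hw : MemTimeL2 T w) :
    Integrable (fun p : ℝ × ℝ => (Ioo 0 T).indicator h p.2 • (Ioo 0 T).indicator w (p.1 - p.2))
      (volume.prod volume) :=
  Integrable.convolution_integrand (ContinuousLinearMap.lsmul ℝ ℂ) hh.integrable_indicator
    hw.integrable_indicator

/-- After extension by zero, `‖h‖ ‖w‖ ≤ ‖h‖² + ‖w‖²` and translation invariance bound the
convolution uniformly in `t`; a bounded measurable function on a finite interval is square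
integrable. -/
lemma memTimeL2_conv (hh : MemTimeL2 T h) (hw : MemTimeL2 T w) : MemTimeL2 T (conv h w) := by
  have he : (fun t => ∫ s, (Ioo 0 T).indicator h s • (Ioo 0 T).indicator w (t - s))
      =ᵐ[timeMeasure T] conv h w := by
    filter_upwards [ae_timeMeasure_mem T] with t ht
    rw [conv_eq_integral (Ioo_subset_Icc_self ht)]
  rw [← memTimeL2_congr he]
  have i1 : Integrable (fun s => ‖(Ioo 0 T).indicator h s‖ ^ 2) :=
    hh.memLp_indicator.integrable_norm_pow (by norm_num)
  have i2 : Integrable (fun s => ‖(Ioo 0 T).indicator w s‖ ^ 2) :=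
    hw.memLp_indicator.integrable_norm_pow (by norm_num)
  refine MemLp.of_bound (C := (∫ s, ‖(Ioo 0 T).indicator h s‖ ^ 2)
    + ∫ s, ‖(Ioo 0 T).indicator w s‖ ^ 2) ?_ (Filter.Eventually.of_forall fun t => ?_)
  · exact (integrable_conv_integrand hh hw).integral_prod_left.aestronglyMeasurable.restrict
  · have i3 := i2.comp_sub_left t
    refine (norm_integral_le_of_norm_le (i1.add i3) (Filter.Eventually.of_forall fun s => ?_)).trans ?_
    · rw [norm_smul]
      simp only [Pi.add_apply]
      nlinarith [sq_nonneg (‖(Ioo 0 T).indicator h s‖ - ‖(Ioo 0 T).indicator w (t - s)‖),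
        sq_nonneg (‖(Ioo 0 T).indicator h s‖), sq_nonneg (‖(Ioo 0 T).indicator w (t - s)‖)]
    · simp only [Pi.add_apply]
      rw [integral_add i1 i3, integral_sub_left_eq_self (fun s => ‖(Ioo 0 T).indicator w s‖ ^ 2)]

lemma intervalIntegrable_conv (hh : MemTimeL2 T h) (hw : MemTimeL2 T w) {t : ℝ}
    (ht : t ∈ Icc 0 T) : IntervalIntegrable (fun s => h (t - s) • w s) volume 0 t := by
  have h1 : MemLp (fun s => (Ioo 0 T).indicator h (t - s)) 2 volume :=
    hh.memLp_indicator.comp_measurePreserving (Measure.measurePreserving_sub_left volume t)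
  have h2 : Integrable (fun s => (Ioo 0 T).indicator h (t - s) • (Ioo 0 T).indicator w s) :=
    memLp_one_iff_integrable.1 (hw.memLp_indicator.smul h1)
  rw [intervalIntegrable_iff_integrableOn_Ioo_of_le ht.1]
  refine h2.integrableOn.congr_fun (fun s hs => ?_) measurableSet_Ioo
  have m1 : s ∈ Ioo 0 T := ⟨hs.1, hs.2.trans_le ht.2⟩
  have m2 : t - s ∈ Ioo 0 T := ⟨by linarith [hs.2], by linarith [hs.1, ht.2]⟩
  simp only [indicator_of_mem m1, indicator_of_mem m2]

lemma map_conv {U : Type*} [NormedAddCommGroup U] [NormedSpace ℂ U] [CompleteSpace U]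
    [CompleteSpace V] (L : V →L[ℂ] U) (hh : MemTimeL2 T h) (hw : MemTimeL2 T w) {t : ℝ}
    (ht : t ∈ Icc 0 T) : L (conv h w t) = conv h (fun s => L (w s)) t := by
  have := (L.restrictScalars ℝ).intervalIntegral_comp_comm (intervalIntegrable_conv hh hw ht)
  simp only [ContinuousLinearMap.coe_restrictScalars', map_smul] at this
  exact this.symm

/-- `h ∗ (1 ∗ w) = 1 ∗ (h ∗ w)`. -/
lemma conv_primitive [CompleteSpace V] (hh : MemTimeL2 T h) (hw : MemTimeL2 T w) {t : ℝ}
    (ht : t ∈ Icc 0 T) :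
    conv h (fun s => ∫ r in (0 : ℝ)..s, w r) t = ∫ s in (0 : ℝ)..t, conv h w s := by
  have hI := integrable_conv_integrand hh hw
  have hI' : Integrable (Function.uncurry fun s σ : ℝ =>
      (Ioo 0 T).indicator h σ • (Ioo 0 T).indicator w (s - σ))
      ((volume.restrict (Ioo 0 t)).prod volume) := by
    have := hI.integrableOn (s := Ioo 0 t ×ˢ univ)
    rw [IntegrableOn, ← Measure.prod_restrict, Measure.restrict_univ] at this
    exact this
  have e1 : ∫ s in (0 : ℝ)..t, conv h w s = ∫ s in Ioo 0 t, ∫ σ,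
      (Ioo 0 T).indicator h σ • (Ioo 0 T).indicator w (s - σ) := by
    rw [intervalIntegral.integral_of_le ht.1, integral_Ioc_eq_integral_Ioo]
    refine setIntegral_congr_fun measurableSet_Ioo fun s hs => ?_
    exact conv_eq_integral ⟨hs.1.le, hs.2.le.trans ht.2⟩
  -- Fubini for the zero extensions: for fixed `σ`, the inner integral becomes the primitive of `w`
  -- at `t - σ`.
  rw [e1, integral_integral_swap hI', conv_eq_swap, intervalIntegral.integral_of_le ht.1,
    integral_Ioc_eq_integral_Ioo]
  refine Eq.trans (setIntegral_congr_fun measurableSet_Ioo fun σ hσ => ?_)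
    (setIntegral_eq_integral_of_forall_compl_eq_zero (s := Ioo 0 t) fun σ hσ => ?_)
  · have h1 : σ ∈ Ioo 0 T := ⟨hσ.1, hσ.2.trans_le ht.2⟩
    simp only [indicator_of_mem h1]
    rw [integral_smul, ← integral_Ioc_eq_integral_Ioo, ← intervalIntegral.integral_of_le ht.1,
      intervalIntegral.integral_comp_sub_right (fun r => (Ioo 0 T).indicator w r)]
    congr 1
    have i1 : ∀ a b : ℝ, IntervalIntegrable ((Ioo 0 T).indicator w) volume a b := fun a b =>
      hw.integrable_indicator.intervalIntegrable
    rw [← intervalIntegral.integral_add_adjacent_intervals (i1 (0 - σ) 0) (i1 0 (t - σ))]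
    -- The shift starts the integral at `-σ`; the zero extension kills the part below `0`.
    have z1 : ∫ r in (0 - σ)..0, (Ioo 0 T).indicator w r = 0 := by
      refine intervalIntegral.integral_zero_ae (Filter.Eventually.of_forall fun r hr => ?_)
      rw [uIoc_of_le (by linarith [hσ.1])] at hr
      exact indicator_of_notMem (fun hm => absurd hr.2 (not_le.2 hm.1)) _
    rw [z1, zero_add]
    refine HasTimePrim.ae_integral_congr (T := T) ?_ ⟨by linarith [hσ.2], by linarith [hσ.1, ht.2]⟩
    filter_upwards [ae_timeMeasure_mem T] with r hr
    rw [indicator_of_mem hr]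
  · by_cases h1 : σ ∈ Ioo 0 T
    · refine integral_eq_zero_of_ae ?_
      filter_upwards [ae_restrict_mem measurableSet_Ioo] with s hs
      have h2 : s - σ ∉ Ioo 0 T := fun h2 => hσ ⟨h1.1, by linarith [h2.1, hs.2]⟩
      rw [indicator_of_notMem h2, smul_zero, Pi.zero_apply]
    · simp only [indicator_of_notMem h1, zero_smul, integral_zero]

/-- `D_t (h ∗ w) = h w(0) + h ∗ D_t w`. -/
lemma HasTimePrim.conv [CompleteSpace V] (hT : 0 < T) {w' : ℝ → V} {c : V} (hh : MemTimeL2 T h)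
    (hw : HasTimePrim T w c w') :
    HasTimePrim T (conv h w) 0 (fun t => h t • c + conv h w' t) := by
  have hhc : MemTimeL2 T (fun t => h t • c) := hh.smul_continuousOn continuousOn_const
  refine ⟨MemLp.add hhc (memTimeL2_conv hh hw.1), ?_⟩
  filter_upwards [ae_timeMeasure_mem T] with t ht
  have ht' := Ioo_subset_Icc_self ht
  have hp : MemTimeL2 T (fun t => ∫ s in (0 : ℝ)..t, w' s) := by
    have := (HasTimePrim.of_memTimeL2 hw.1 (0 : V)).memTimeL2 hT
    simpa only [zero_add] using this
  rw [conv_congr hw.2 ht', zero_add, intervalIntegral.integral_add (hhc.intervalIntegrable' hT ht')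
    ((memTimeL2_conv hh hw.1).intervalIntegrable' hT ht'), ← conv_primitive hh hw.1 ht',
    intervalIntegral.integral_smul_const]
  -- After this reflection the primitive of `h c` is the convolution of `h` with the constant `c`,
  -- which merges with `h ∗ (1 ∗ w')`.
  have e1 : ∫ s in (0 : ℝ)..t, h s = ∫ s in (0 : ℝ)..t, h (t - s) := by
    rw [intervalIntegral.integral_comp_sub_left (fun s => h s) t]
    simp
  rw [e1, ← intervalIntegral.integral_smul_const]
  unfold InverseControl.conv
  rw [← intervalIntegral.integral_add
    (intervalIntegrable_conv hh (memTimeL2_of_continuousOn continuousOn_const) ht')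
    (intervalIntegrable_conv hh hp ht')]
  simp only [smul_add]

end Convolution

/-! ### Multiplication and pairing in `L²`; the Sobolev spaces. -/

section

section Multipliers

variable {X : Type*} [MeasurableSpace X] {μ : Measure X}

/-- Multiplication by an essentially bounded function is a bounded operator in `L²`. -/
lemma exists_mul_clm {m : X → ℂ} (hm : MemLp m ⊤ μ) :
    ∃ L : Lp ℂ 2 μ →L[ℂ] Lp ℂ 2 μ, ∀ w, L w =ᵐ[μ] fun x => m x * w x := by
  refine ⟨(ContinuousLinearMap.mul ℂ ℂ).holderL μ ⊤ 2 2 hm.toLp, fun w => ?_⟩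
  rw [ContinuousLinearMap.holderL_apply_apply]
  filter_upwards [(ContinuousLinearMap.mul ℂ ℂ).coeFn_holder (r := 2) hm.toLp w, hm.coeFn_toLp]
    with x h1 h2
  rw [h1, h2]
  rfl

/-- The bilinear pairing `(φ, w) ↦ ∫ φ w dμ` in `L²`. -/
def l2Pair (μ : Measure X) : Lp ℂ 2 μ →L[ℂ] Lp ℂ 2 μ →L[ℂ] ℂ :=
  (ContinuousLinearMap.mul ℂ ℂ).lpPairing μ 2 2

lemma l2Pair_apply (φ w : Lp ℂ 2 μ) : l2Pair μ φ w = ∫ x, φ x * w x ∂μ :=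
  (ContinuousLinearMap.mul ℂ ℂ).lpPairing_eq_integral φ w

lemma coeFn_sum_apply {ι : Type*} (s : Finset ι) (f : ι → Lp ℂ 2 μ) :
    (↑(∑ i ∈ s, f i) : X → ℂ) =ᵐ[μ] fun x => ∑ i ∈ s, f i x := by
  classical
  induction s using Finset.induction_on with
  | empty =>
    simp only [Finset.sum_empty]
    exact Lp.coeFn_zero ℂ 2 μ
  | insert a s ha ih =>
    rw [Finset.sum_insert ha]
    filter_upwards [Lp.coeFn_add (f a) (∑ i ∈ s, f i), ih] with x h1 h2
    rw [h1, Pi.add_apply, h2, Finset.sum_insert ha]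

end Multipliers

variable {n : ℕ} {Ω : Set (E n)}

lemma toL2_eq {μ : Measure (E n)} {F : E n → ℂ} {f : Lp ℂ 2 μ} (h : f =ᵐ[μ] F) : toL2 μ F = f := by
  have hF : MemLp F 2 μ := (memLp_congr_ae h).1 (Lp.memLp f)
  rw [toL2, dif_pos hF]
  exact Lp.ext (hF.coeFn_toLp.trans h.symm)

lemma memLp_top_of_eqOn {μ : Measure (E n)} {S K : Set (E n)} (hS : MeasurableSet S)
    (hK : IsCompact K) (hSK : S ⊆ K) {m G : E n → ℂ} (hG : Continuous G) (h : EqOn m G S) :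
    MemLp m ⊤ (μ.restrict S) := by
  obtain ⟨C, hC⟩ := hK.exists_bound_of_continuousOn hG.continuousOn
  have he : m =ᵐ[μ.restrict S] G := by
    filter_upwards [ae_restrict_mem hS] with x hx using h hx
  refine (memLp_congr_ae he).2 (memLp_top_of_bound hG.aestronglyMeasurable C ?_)
  filter_upwards [ae_restrict_mem hS] with x hx using hC x (hSK hx)

/-! ### Completeness of the Sobolev spaces -/

/-- The inclusion `H¹(Ω) → L²(Ω)` as a bounded operator. -/
def H1.fnL (Ω : Set (E n)) : H1 Ω →L[ℂ] L2 Ω :=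
  (PiLp.proj 2 (fun _ : Option (Fin n) => L2 Ω) none).comp (H1Sub Ω).subtypeL

/-- `D_{x_i} : H¹(Ω) → L²(Ω)` as a bounded operator. -/
def H1.DL (Ω : Set (E n)) (i : Fin n) : H1 Ω →L[ℂ] L2 Ω :=
  (PiLp.proj 2 (fun _ : Option (Fin n) => L2 Ω) (some i)).comp (H1Sub Ω).subtypeL

/-- The inclusion `H²(Ω) → H¹(Ω)` as a bounded operator. -/
def H2.toH1L (Ω : Set (E n)) : H2 Ω →L[ℂ] H1 Ω :=
  (PiLp.proj 2 (fun _ : Option (Fin n) => H1 Ω) none).comp (H2Sub Ω).subtypeL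

/-- `D_{x_i} : H²(Ω) → H¹(Ω)` as a bounded operator. -/
def H2.DL (Ω : Set (E n)) (i : Fin n) : H2 Ω →L[ℂ] H1 Ω :=
  (PiLp.proj 2 (fun _ : Option (Fin n) => H1 Ω) (some i)).comp (H2Sub Ω).subtypeL

/-- The inclusion `H²(Ω) → L²(Ω)` as a bounded operator. -/
def H2.fnL (Ω : Set (E n)) : H2 Ω →L[ℂ] L2 Ω := (H1.fnL Ω).comp (H2.toH1L Ω)

lemma H2.toH1L_apply (w : H2 Ω) : H2.toH1L Ω w = w.toH1 := rfl
lemma H2.DL_apply (i : Fin n) (w : H2 Ω) : H2.DL Ω i w = w.D i := rfl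

lemma integral_test_eq_l2Pair (w : L2 Ω) {φ : E n → ℂ} (hφ : MemLp φ 2 (volume.restrict Ω)) :
    ∫ x in Ω, w x * φ x = l2Pair (volume.restrict Ω) w hφ.toLp := by
  rw [l2Pair_apply]
  refine integral_congr_ae ?_
  filter_upwards [hφ.coeFn_toLp] with x hx
  rw [hx]

/-- Each weak-derivative identity compares two continuous functionals, so it cuts out a closed set.
The completeness that follows is needed for integrals with values in the Sobolev spaces. -/
lemma isClosed_H1Sub (Ω : Set (E n)) :
    IsClosed (H1Sub Ω : Set (PiLp 2 (fun _ : Option (Fin n) => L2 Ω))) := by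
  have : (H1Sub Ω : Set (PiLp 2 (fun _ : Option (Fin n) => L2 Ω))) =
      ⋂ (i : Fin n) (φ : E n → ℂ) (_ : IsTest Ω φ), {p | ∫ x in Ω, p none x * pderiv i φ x
        = - ∫ x in Ω, p (some i) x * φ x} := by
    ext p
    simp only [mem_iInter]
    rfl
  rw [this]
  refine isClosed_iInter fun i => isClosed_iInter fun φ => isClosed_iInter fun hφ => ?_
  have m1 := memLp_of_test (Ω := Ω) hφ.1.continuous hφ.2.1
  have m2 := memLp_of_test (Ω := Ω) (continuous_pderiv hφ.1 i) (hasCompactSupport_pderiv hφ.2.1 i)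
  simp only [integral_test_eq_l2Pair _ m1, integral_test_eq_l2Pair _ m2]
  refine isClosed_eq ?_ ?_
  · exact ((l2Pair (volume.restrict Ω)).flip m2.toLp).continuous.comp
      (PiLp.proj (𝕜 := ℂ) 2 (fun _ : Option (Fin n) => L2 Ω) none).continuous
  · exact (((l2Pair (volume.restrict Ω)).flip m1.toLp).continuous.comp
      (PiLp.proj (𝕜 := ℂ) 2 (fun _ : Option (Fin n) => L2 Ω) (some i)).continuous).neg

instance (Ω : Set (E n)) : CompleteSpace (H1 Ω) := (isClosed_H1Sub Ω).completeSpace_coe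

lemma isClosed_H2Sub (Ω : Set (E n)) :
    IsClosed (H2Sub Ω : Set (PiLp 2 (fun _ : Option (Fin n) => H1 Ω))) := by
  have : (H2Sub Ω : Set (PiLp 2 (fun _ : Option (Fin n) => H1 Ω))) =
      ⋂ (i : Fin n), {p | (p (some i)).fn = (p none).D i} := by
    ext p
    simp only [mem_iInter]
    rfl
  rw [this]
  refine isClosed_iInter fun i => isClosed_eq ?_ ?_
  · exact (H1.fnL Ω).continuous.comp
      (PiLp.proj (𝕜 := ℂ) 2 (fun _ : Option (Fin n) => H1 Ω) (some i)).continuous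
  · exact (H1.DL Ω i).continuous.comp
      (PiLp.proj (𝕜 := ℂ) 2 (fun _ : Option (Fin n) => H1 Ω) none).continuous

instance (Ω : Set (E n)) : CompleteSpace (H2 Ω) := (isClosed_H2Sub Ω).completeSpace_coe

/- The next two instances are shortcuts: without them the instance search runs through
`InnerProductSpace` and does not terminate in time. -/
scoped instance (Ω : Set (E n)) : NormedAddCommGroup (H2 Ω) := inferInstance

scoped instance (Ω : Set (E n)) : NormedSpace ℂ (H2 Ω) := inferInstance

/-! ### Weak derivatives of test functions -/

lemma isTest_pderiv {φ : E n → ℂ} (hφ : IsTest Ω φ) (i : Fin n) : IsTest Ω (pderiv i φ) := by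
  refine ⟨?_, hasCompactSupport_pderiv hφ.2.1 i, ?_⟩
  · exact (hφ.1.fderiv_right (by simp)).clm_apply contDiff_const
  · exact (closure_mono fun x hx => by
      by_contra hn
      exact hx (by simp [pderiv, image_eq_zero_of_notMem_tsupport (fun h => hn h)]) :
        tsupport (pderiv i φ) ⊆ closure (tsupport (fderiv ℝ φ))).trans (by
        rw [(isClosed_tsupport _).closure_eq]
        exact (tsupport_fderiv_subset ℝ).trans hφ.2.2)

lemma isTest_mul {φ G : E n → ℂ} (hφ : IsTest Ω φ) (hG : ContDiff ℝ (⊤ : ℕ∞) G) :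
    IsTest Ω (fun x => φ x * G x) :=
  ⟨hφ.1.mul hG, hφ.2.1.mul_right, (tsupport_mul_subset_left).trans hφ.2.2⟩

lemma pderiv_mul {φ G : E n → ℂ} (hφ : ContDiff ℝ (⊤ : ℕ∞) φ) (hG : ContDiff ℝ (⊤ : ℕ∞) G)
    (i : Fin n) (x : E n) :
    pderiv i (fun x => φ x * G x) x = pderiv i φ x * G x + φ x * pderiv i G x := by
  unfold pderiv
  rw [fderiv_fun_mul (hφ.differentiable (by simp) x) (hG.differentiable (by simp) x)]
  simp only [add_apply, smul_apply, smul_eq_mul]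
  ring

/-- As `η` is compactly supported in `Ω`, both integrals extend to the whole space, where
integration by parts has no boundary term. -/
lemma integral_mul_pderiv {φ η : E n → ℂ} (hφ : ContDiff ℝ (⊤ : ℕ∞) φ) (hη : IsTest Ω η)
    (i : Fin n) : ∫ x in Ω, φ x * pderiv i η x = - ∫ x in Ω, pderiv i φ x * η x := by
  have hη' := isTest_pderiv hη i
  have c1 := continuous_pderiv hφ i
  have hs : ∀ {f η : E n → ℂ}, IsTest Ω η → ∀ x, x ∉ Ω → f x * η x = 0 := fun hη x hx => by
    rw [image_eq_zero_of_notMem_tsupport fun hm => hx (hη.2.2 hm), mul_zero]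
  rw [setIntegral_eq_integral_of_forall_compl_eq_zero (hs hη'),
    setIntegral_eq_integral_of_forall_compl_eq_zero (hs hη)]
  have hi : ∀ {f η : E n → ℂ}, Continuous f → IsTest Ω η → Integrable (fun x => f x * η x) :=
    fun hf hη => (hf.mul hη.1.continuous).integrable_of_hasCompactSupport hη.2.1.mul_left
  exact integral_mul_fderiv_eq_neg_fderiv_mul_of_integrable (hi c1 hη) (hi hφ.continuous hη')
    (hi hφ.continuous hη) (fun x _ => hφ.differentiable (by simp) x)
    (fun x _ => hη.1.differentiable (by simp) x)

/-- A weak derivative of a smooth function is its classical derivative. -/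
lemma IsWeakPartial.ae_eq_pderiv (hΩ : IsOpen Ω) {i : Fin n} {w g : L2 Ω}
    (h : IsWeakPartial Ω i w g) {φ : E n → ℂ} (hφ : ContDiff ℝ (⊤ : ℕ∞) φ)
    (hw : w =ᵐ[volume.restrict Ω] φ) : g =ᵐ[volume.restrict Ω] pderiv i φ := by
  have hc := continuous_pderiv hφ i
  have hgl : LocallyIntegrable g (volume.restrict Ω) := (Lp.memLp g).locallyIntegrable (by norm_num)
  have hpl : LocallyIntegrable (pderiv i φ) (volume.restrict Ω) := hc.locallyIntegrable
  have key := hΩ.ae_eq_zero_of_integral_contDiff_smul_eq_zero (μ := volume.restrict Ω)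
    (f := fun x => g x - pderiv i φ x) ((hgl.sub hpl).locallyIntegrableOn Ω) (by
      intro η h1 h2 h3
      -- The fundamental lemma tests with real functions; they are complexified to fit the
      -- definition of weak derivative.
      have hη : IsTest Ω (fun x => (η x : ℂ)) := by
        refine ⟨Complex.ofRealCLM.contDiff.comp h1, h2.comp_left Complex.ofReal_zero, ?_⟩
        exact (closure_mono (show Function.support (fun x => (η x : ℂ)) ⊆ Function.support η from
          fun x hx hn => hx (by simp [hn]))).trans h3
      have e1 := h _ hη
      have e2 := integral_mul_pderiv hφ hη i
      have e3 : ∫ x in Ω, w x * pderiv i (fun x => (η x : ℂ)) x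
          = ∫ x in Ω, φ x * pderiv i (fun x => (η x : ℂ)) x := by
        refine integral_congr_ae ?_
        filter_upwards [hw] with x hx
        rw [hx]
      have i1 : Integrable (fun x => g x * (η x : ℂ)) (volume.restrict Ω) :=
        integrable_mul_cc g hη.1.continuous hη.2.1
      have i2 : Integrable (fun x => pderiv i φ x * (η x : ℂ)) (volume.restrict Ω) :=
        ((hc.mul hη.1.continuous).integrable_of_hasCompactSupport hη.2.1.mul_left).integrableOn
      have e4 : ∫ x in Ω, η x • (g x - pderiv i φ x)
          = (∫ x in Ω, g x * (η x : ℂ)) - ∫ x in Ω, pderiv i φ x * (η x : ℂ) := by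
        rw [← integral_sub i1 i2]
        refine integral_congr_ae (Filter.Eventually.of_forall fun x => ?_)
        simp only [Complex.real_smul]
        ring
      rw [e4, sub_eq_zero]
      exact neg_injective (by rw [← e1, ← e2, e3]))
  filter_upwards [key, ae_restrict_mem hΩ.measurableSet] with x hx hm
  exact sub_eq_zero.1 (hx hm)

lemma H1.D_ae_eq (hΩ : IsOpen Ω) {w : H1 Ω} {φ : E n → ℂ} (hφ : ContDiff ℝ (⊤ : ℕ∞) φ)
    (hw : w.fn =ᵐ[volume.restrict Ω] φ) (i : Fin n) :
    w.D i =ᵐ[volume.restrict Ω] pderiv i φ := (w.2 i).ae_eq_pderiv hΩ hφ hw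

lemma H2.D_fn (w : H2 Ω) (i : Fin n) : (w.D i).fn = w.toH1.D i := w.2 i

lemma H1.eq_zero_of_fn (hΩ : IsOpen Ω) {w : H1 Ω} (hw : w.fn = 0) : w = 0 := by
  have h0 : w.fn =ᵐ[volume.restrict Ω] (fun _ => (0 : ℂ)) := by
    rw [hw]
    exact Lp.coeFn_zero ℂ 2 _
  refine Subtype.ext (PiLp.ext fun k => ?_)
  rcases k with _ | i
  · exact hw
  · refine Lp.ext (((H1.D_ae_eq hΩ contDiff_const h0 i)).trans ?_)
    have hz : pderiv i (fun _ : E n => (0 : ℂ)) = 0 := by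
      ext x
      simp [pderiv]
    rw [hz]
    exact (Lp.coeFn_zero ℂ 2 _).symm

lemma H2.eq_zero_of_fn (hΩ : IsOpen Ω) {w : H2 Ω} (hw : w.fn = 0) : w = 0 := by
  have h1 : w.toH1 = 0 := H1.eq_zero_of_fn hΩ hw
  refine Subtype.ext (PiLp.ext fun k => ?_)
  rcases k with _ | i
  · exact h1
  · refine H1.eq_zero_of_fn hΩ ?_
    change (w.D i).fn = 0
    rw [w.D_fn, h1]
    rfl

/-- Elements of `H²(Ω)` carry their derivatives as components, but weak derivatives are unique. This
upgrades the initial condition from `L²(Ω)` to `H²(Ω)`. -/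
lemma H2.fn_injective (hΩ : IsOpen Ω) : Function.Injective (H2.fn : H2 Ω → L2 Ω) :=
  (injective_iff_map_eq_zero (H2.fnL Ω)).2 fun _ hw => H2.eq_zero_of_fn hΩ hw

end

section

variable {n : ℕ} {Ω : Set (E n)}

/-! ### Operators in divergence form -/

lemma pderiv_eqOn (hΩ : IsOpen Ω) {c G : E n → ℂ} (h : EqOn c G Ω) (i : Fin n) :
    EqOn (pderiv i c) (pderiv i G) Ω := fun x hx => by
  unfold pderiv
  rw [Filter.EventuallyEq.fderiv_eq (Filter.eventuallyEq_of_mem (hΩ.mem_nhds hx) h)]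

/-- The integrand of `divForm`. -/
def divFormFun (c : Fin n → Fin n → E n → ℂ) (w : H2 Ω) (x : E n) : ℂ :=
  ∑ i, ∑ j, (c i j x * ((w.D j).D i) x + pderiv i (c i j) x * ((w.D j).fn) x)

/-- On the bounded set `Ω` the coefficients and their derivatives are essentially bounded, hence
multipliers of `L²(Ω)`. In particular `toL2` never takes its default value in `divForm`. -/
lemma exists_divForm_clm (hΩ : IsOpen Ω) (hb : Bornology.IsBounded Ω)
    {c : Fin n → Fin n → E n → ℂ} (hc : ∀ i j, IsSmoothOn (c i j) (closure Ω)) :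
    ∃ L : H2 Ω →L[ℂ] L2 Ω, ∀ w, divForm c w = L w ∧ L w =ᵐ[volume.restrict Ω] divFormFun c w := by
  choose G hG hcG using hc
  have hK := hb.isCompact_closure
  have h1 : ∀ i j, MemLp (c i j) ⊤ (volume.restrict Ω) := fun i j =>
    memLp_top_of_eqOn hΩ.measurableSet hK subset_closure (hG i j).continuous
      ((hcG i j).mono subset_closure)
  have h2 : ∀ i j, MemLp (pderiv i (c i j)) ⊤ (volume.restrict Ω) := fun i j =>
    memLp_top_of_eqOn hΩ.measurableSet hK subset_closure (continuous_pderiv (hG i j) i)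
      (pderiv_eqOn hΩ ((hcG i j).mono subset_closure) i)
  choose M hM using fun i j => exists_mul_clm (h1 i j)
  choose N hN using fun i j => exists_mul_clm (h2 i j)
  let S : Fin n → Fin n → H2 Ω →L[ℂ] L2 Ω := fun i j =>
    (M i j).comp ((H1.DL Ω i).comp (H2.DL Ω j)) + (N i j).comp ((H1.fnL Ω).comp (H2.DL Ω j))
  have key : ∀ w, (∑ i, ∑ j, S i j) w =ᵐ[volume.restrict Ω] divFormFun c w := by
    intro w
    simp only [sum_apply]
    have e1 := coeFn_sum_apply (μ := volume.restrict Ω) Finset.univ fun i => ∑ j, S i j w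
    have e2 : ∀ᵐ x ∂volume.restrict Ω, ∀ i, (∑ j, S i j w : L2 Ω) x = ∑ j, (S i j w) x :=
      ae_all_iff.2 fun i => coeFn_sum_apply (μ := volume.restrict Ω) Finset.univ fun j => S i j w
    have e3 : ∀ᵐ x ∂volume.restrict Ω, ∀ i j, (S i j w) x
        = c i j x * ((w.D j).D i) x + pderiv i (c i j) x * ((w.D j).fn) x := by
      refine ae_all_iff.2 fun i => ae_all_iff.2 fun j => ?_
      filter_upwards [Lp.coeFn_add (M i j ((w.D j).D i)) (N i j ((w.D j).fn)),
        hM i j ((w.D j).D i), hN i j ((w.D j).fn)] with x p1 p2 p3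
      rw [← p2, ← p3]
      exact p1
    filter_upwards [e1, e2, e3] with x p1 p2 p3
    rw [p1]
    unfold divFormFun
    refine Finset.sum_congr rfl fun i _ => ?_
    rw [p2]
    exact Finset.sum_congr rfl fun j _ => p3 i j
  exact ⟨∑ i, ∑ j, S i j, fun w => ⟨toL2_eq (key w), key w⟩⟩

/-- Integration by parts against a test function, for one term of an operator in divergence
form. -/
lemma integral_test_mul_term {φ G : E n → ℂ} (hφ : IsTest Ω φ) (hG : ContDiff ℝ (⊤ : ℕ∞) G)
    (w : H2 Ω) (i j : Fin n) :
    (∫ x in Ω, ((w.D j).D i) x * (φ x * G x) + ((w.D j).fn) x * (φ x * pderiv i G x))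
      = ∫ x in Ω, w.fn x * (pderiv j (pderiv i φ) x * G x + pderiv i φ x * pderiv j G x) := by
  have hφi := isTest_pderiv hφ i
  have cφ := hφ.1.continuous
  have cG := hG.continuous
  have ci := continuous_pderiv hG i
  have a1 := (w.D j).2 i _ (isTest_mul hφ hG)
  have a2 := w.toH1.2 j _ (isTest_mul hφi hG)
  change ∫ x in Ω, (w.D j).fn x * pderiv i _ x = - ∫ x in Ω, (w.D j).D i x * _ at a1
  change ∫ x in Ω, w.fn x * pderiv j _ x = - ∫ x in Ω, w.toH1.D j x * _ at a2
  simp only [pderiv_mul hφ.1 hG] at a1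
  simp only [pderiv_mul hφi.1 hG] at a2
  rw [← w.D_fn] at a2
  have i1 : Integrable (fun x => ((w.D j).D i) x * (φ x * G x)) (volume.restrict Ω) :=
    integrable_mul_cc _ (cφ.mul cG) hφ.2.1.mul_right
  have i2 : Integrable (fun x => ((w.D j).fn) x * (φ x * pderiv i G x)) (volume.restrict Ω) :=
    integrable_mul_cc _ (cφ.mul ci) hφ.2.1.mul_right
  have i3 : Integrable (fun x => ((w.D j).fn) x * (pderiv i φ x * G x)) (volume.restrict Ω) :=
    integrable_mul_cc _ (hφi.1.continuous.mul cG) hφi.2.1.mul_right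
  simp only [mul_add] at a1
  rw [integral_add i3 i2] at a1
  rw [integral_add i1 i2, a2]
  linear_combination a1

/-- Green's formula for operators in divergence form, tested with an element of `H²₀(Ω)`. -/
lemma integral_mul_divForm (hΩ : IsOpen Ω) (hb : Bornology.IsBounded Ω)
    {c : Fin n → Fin n → E n → ℂ} (hc : ∀ i j, IsSmoothOn (c i j) (closure Ω))
    {ω : H2 Ω} (hω : ω ∈ H20 Ω) (w : H2 Ω) :
    ∫ x in Ω, ω.fn x * divForm c w x = ∫ x in Ω, divForm (fun i j => c j i) ω x * w.fn x := by
  obtain ⟨L, hL⟩ := exists_divForm_clm hΩ hb hc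
  obtain ⟨L', hL'⟩ := exists_divForm_clm (c := fun i j => c j i) hΩ hb fun i j => hc j i
  choose G hG hcG using hc
  -- Both sides are continuous in `ω` for the `H²` norm, so by the definition of `H20` it suffices
  -- to treat test functions.
  have hcl : IsClosed {ω : H2 Ω | l2Pair (volume.restrict Ω) ω.fn (divForm c w)
      = l2Pair (volume.restrict Ω) (divForm (fun i j => c j i) ω) w.fn} := by
    simp only [(hL' _).1]
    exact isClosed_eq ((((l2Pair (volume.restrict Ω)).flip (divForm c w)).comp (H2.fnL Ω)).continuous)
      ((((l2Pair (volume.restrict Ω)).flip w.fn).comp L').continuous)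
  suffices hs : ∀ ω ∈ {w : H2 Ω | ∃ φ : E n → ℂ, IsTest Ω φ ∧ w.fn =ᵐ[volume.restrict Ω] φ},
      l2Pair (volume.restrict Ω) ω.fn (divForm c w)
        = l2Pair (volume.restrict Ω) (divForm (fun i j => c j i) ω) w.fn by
    have key : l2Pair (volume.restrict Ω) ω.fn (divForm c w)
        = l2Pair (volume.restrict Ω) (divForm (fun i j => c j i) ω) w.fn :=
      closure_minimal hs hcl hω
    simpa only [l2Pair_apply] using key
  rintro ω ⟨φ, hφ, hωφ⟩
  have d1 : ∀ i, (ω.D i).fn =ᵐ[volume.restrict Ω] pderiv i φ := fun i => by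
    rw [ω.D_fn]
    exact H1.D_ae_eq hΩ hφ.1 hωφ i
  have d2 : ∀ i j, (ω.D i).D j =ᵐ[volume.restrict Ω] pderiv j (pderiv i φ) := fun i j =>
    H1.D_ae_eq hΩ (isTest_pderiv hφ i).1 (d1 i) j
  rw [l2Pair_apply, l2Pair_apply, (hL w).1, (hL' ω).1]
  have e1 : ∫ x in Ω, ω.fn x * L w x = ∫ x in Ω, ∑ i, ∑ j, (((w.D j).D i) x * (φ x * G i j x)
      + ((w.D j).fn) x * (φ x * pderiv i (G i j) x)) := by
    refine integral_congr_ae ?_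
    filter_upwards [(hL w).2, hωφ, ae_restrict_mem hΩ.measurableSet] with x p1 p2 hx
    rw [p1, p2]
    unfold divFormFun
    simp only [Finset.mul_sum]
    refine Finset.sum_congr rfl fun i _ => Finset.sum_congr rfl fun j _ => ?_
    rw [hcG i j (subset_closure hx), pderiv_eqOn hΩ ((hcG i j).mono subset_closure) i hx]
    ring
  have e2 : ∫ x in Ω, L' ω x * w.fn x = ∫ x in Ω, ∑ i, ∑ j,
      w.fn x * (pderiv j (pderiv i φ) x * G i j x + pderiv i φ x * pderiv j (G i j) x) := by
    refine integral_congr_ae ?_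
    have p3 : ∀ᵐ x ∂volume.restrict Ω, ∀ i, (ω.D i).fn x = pderiv i φ x := ae_all_iff.2 d1
    have p4 : ∀ᵐ x ∂volume.restrict Ω, ∀ i j, (ω.D i).D j x = pderiv j (pderiv i φ) x :=
      ae_all_iff.2 fun i => ae_all_iff.2 fun j => d2 i j
    filter_upwards [(hL' ω).2, p3, p4, ae_restrict_mem hΩ.measurableSet] with x p1 p3 p4 hx
    rw [p1]
    unfold divFormFun
    -- Exchanging the indices matches the transposed coefficients with the summation order of the
    -- other side.
    rw [Finset.sum_comm]
    simp only [Finset.sum_mul]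
    refine Finset.sum_congr rfl fun i _ => Finset.sum_congr rfl fun j _ => ?_
    rw [hcG i j (subset_closure hx), pderiv_eqOn hΩ ((hcG i j).mono subset_closure) j hx, p3, p4]
    ring
  rw [e1, e2]
  have cφ := hφ.1.continuous
  have i1 : ∀ i j, Integrable (fun x => ((w.D j).D i) x * (φ x * G i j x)
      + ((w.D j).fn) x * (φ x * pderiv i (G i j) x)) (volume.restrict Ω) := fun i j =>
    (integrable_mul_cc _ (cφ.mul (hG i j).continuous) hφ.2.1.mul_right).add
      (integrable_mul_cc _ (cφ.mul (continuous_pderiv (hG i j) i)) hφ.2.1.mul_right)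
  have i2 : ∀ i j, Integrable (fun x => w.fn x * (pderiv j (pderiv i φ) x * G i j x
      + pderiv i φ x * pderiv j (G i j) x)) (volume.restrict Ω) := fun i j => by
    have t1 := isTest_pderiv hφ i
    have t2 := isTest_pderiv t1 j
    exact integrable_mul_cc _ ((t2.1.continuous.mul (hG i j).continuous).add
      (t1.1.continuous.mul (continuous_pderiv (hG i j) j))) (t2.2.1.mul_right.add t1.2.1.mul_right)
  rw [integral_finsetSum _ fun i _ => integrable_finsetSum _ fun j _ => i1 i j,
    integral_finsetSum _ fun i _ => integrable_finsetSum _ fun j _ => i2 i j]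
  refine Finset.sum_congr rfl fun i _ => ?_
  rw [integral_finsetSum _ fun j _ => i1 i j, integral_finsetSum _ fun j _ => i2 i j]
  exact Finset.sum_congr rfl fun j _ => integral_test_mul_term hφ (hG i j) w i j

/-- Conjugation is a real-linear isomorphism, so no differentiability is needed; the coefficients
are only known to coincide with smooth functions on a closed set. -/
lemma pderiv_conj (c : E n → ℂ) (i : Fin n) (x : E n) :
    pderiv i (fun x => star (c x)) x = star (pderiv i c x) := by
  have h : fderiv ℝ (fun x => star (c x)) x
      = Complex.conjCLE.toContinuousLinearMap.comp (fderiv ℝ c x) :=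
    Complex.conjCLE.comp_fderiv (f := c) (x := x)
  unfold pderiv
  rw [h]
  rfl

lemma isSmoothOn_conj {c : E n → ℂ} {S : Set (E n)} (hc : IsSmoothOn c S) :
    IsSmoothOn (fun x => star (c x)) S := by
  obtain ⟨G, hG, h⟩ := hc
  exact ⟨fun x => star (G x), Complex.conjCLE.contDiff.comp hG, fun x hx => by simp only [h hx]⟩

/-- The conjugations of the coefficients, the argument and the result cancel. For `ψ₁` this leaves
the operator with transposed coefficients, without conjugates, as in Green's formula for the
bilinear pairing. -/
lemma star_divForm_conj (hΩ : IsOpen Ω) (hb : Bornology.IsBounded Ω)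
    {c : Fin n → Fin n → E n → ℂ} (hc : ∀ i j, IsSmoothOn (c i j) (closure Ω)) (w : H2 Ω) :
    star (divForm (fun i j x => star (c i j x)) w.conj) = divForm c w := by
  obtain ⟨L, hL⟩ := exists_divForm_clm hΩ hb hc
  obtain ⟨L', hL'⟩ := exists_divForm_clm (c := fun i j x => star (c i j x)) hΩ hb
    fun i j => isSmoothOn_conj (hc i j)
  rw [(hL w).1, (hL' _).1]
  refine Lp.ext ?_
  have p3 : ∀ᵐ x ∂volume.restrict Ω, ∀ i, (w.conj.D i).fn x = star ((w.D i).fn x) :=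
    ae_all_iff.2 fun i => Lp.coeFn_star (w.D i).fn
  have p4 : ∀ᵐ x ∂volume.restrict Ω, ∀ i j, (w.conj.D i).D j x = star ((w.D i).D j x) :=
    ae_all_iff.2 fun i => ae_all_iff.2 fun j => Lp.coeFn_star ((w.D i).D j)
  filter_upwards [(hL w).2, (hL' w.conj).2, Lp.coeFn_star (L' w.conj), p3, p4] with x p1 p2 p5 p3 p4
  rw [p1, p5, Pi.star_apply, p2]
  unfold divFormFun
  simp only [star_sum, star_add, star_mul', p3, p4, pderiv_conj, star_star]

/-! ### The operators of the problem as bounded operators -/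

namespace Data

variable {P : Data n}

lemma Admissible.exists_A (hP : P.Admissible) : ∃ L : H2 P.Ω →L[ℂ] L2 P.Ω, ∀ w, P.A w = L w := by
  obtain ⟨L, hL⟩ := exists_divForm_clm hP.domain.1 hP.domain.2.1 hP.a_smooth
  exact ⟨L, fun w => (hL w).1⟩

lemma exists_mul_clm_surf (hb : Bornology.IsBounded Ω) {c : E n → ℂ}
    (hc : IsSmoothOn c (frontier Ω)) :
    ∃ L : L2Γ Ω →L[ℂ] L2Γ Ω, ∀ w, L w =ᵐ[surf Ω] fun x => c x * w x := by
  obtain ⟨G, hG, h⟩ := hc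
  have hK : IsCompact (frontier Ω) :=
    hb.isCompact_closure.of_isClosed_subset isClosed_frontier frontier_subset_closure
  exact exists_mul_clm (memLp_top_of_eqOn isClosed_frontier.measurableSet hK subset_rfl
    hG.continuous h)

lemma Admissible.exists_B (hP : P.Admissible) : ∃ L : H2 P.Ω →L[ℂ] L2Γ P.Ω, ∀ w, P.B w = L w := by
  choose M hM using fun i => exists_mul_clm_surf hP.domain.2.1 (hP.b_smooth i)
  obtain ⟨N, hN⟩ := exists_mul_clm_surf hP.domain.2.1 hP.b₀_smooth
  refine ⟨(∑ i, (M i).comp ((trace P.Ω).comp (H2.DL P.Ω i)))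
    + N.comp ((trace P.Ω).comp (H2.toH1L P.Ω)), fun w => toL2_eq ?_⟩
  simp only [add_apply, sum_apply, ContinuousLinearMap.comp_apply, H2.DL_apply,
    H2.toH1L_apply]
  have e1 : ∀ᵐ x ∂surf P.Ω, ∀ i, (M i (trace P.Ω (w.D i))) x
      = P.b i x * (trace P.Ω (w.D i)) x := ae_all_iff.2 fun i => hM i _
  filter_upwards [e1, hN (trace P.Ω w.toH1),
    Lp.coeFn_add (∑ i, M i (trace P.Ω (w.D i))) (N (trace P.Ω w.toH1)),
    coeFn_sum_apply Finset.univ fun i => M i (trace P.Ω (w.D i))] with x p1 p2 p3 p4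
  rw [p3, Pi.add_apply, p2, p4]
  simp only [p1]
  rfl

variable (P)

def trL : H2 P.Ω →L[ℂ] L2Γ P.Ω := (trace P.Ω).comp (H2.toH1L P.Ω)

lemma trL_apply (w : H2 P.Ω) : P.trL w = P.tr w := rfl

def PhiL : L2 P.Ω →L[ℂ] ℂ := l2Pair (volume.restrict P.Ω) P.ω.fn

lemma PhiL_apply (w : L2 P.Ω) : P.PhiL w = P.Phi w := l2Pair_apply _ _

def pairL : L2 P.Ω →L[ℂ] ℂ := l2Pair (volume.restrict P.Ω) P.ψ₁

lemma pairL_apply (w : L2 P.Ω) : P.pairL w = P.pair w := l2Pair_apply _ _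

def ML : H2 P.Ω →L[ℂ] ℂ :=
  (l2Pair (volume.restrict P.Ω) P.ω₁).comp (H2.fnL P.Ω) + (l2Pair (surf P.Ω) P.ω₂).comp P.trL

lemma ML_apply (w : H2 P.Ω) : P.ML w = P.M w :=
  congrArg₂ (· + ·) (l2Pair_apply _ _) (l2Pair_apply _ _)

variable {P}

/-- `(ψ₁, w) = χ Φ(A w)`. -/
lemma Admissible.pair_eq (hP : P.Admissible) (w : H2 P.Ω) : P.pair w.fn = P.χ * P.Phi (P.A w) := by
  have h1 : star (P.Astar P.ω.conj) = divForm (fun i j => P.a j i) P.ω :=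
    star_divForm_conj hP.domain.1 hP.domain.2.1 (c := fun i j => P.a j i)
      (fun i j => hP.a_smooth j i) P.ω
  rw [← pairL_apply, pairL, ψ₁, h1, map_smul, smul_apply, l2Pair_apply,
    ← integral_mul_divForm hP.domain.1 hP.domain.2.1 hP.a_smooth hP.ω_mem, smul_eq_mul]
  rfl

end Data

end

/-! ### Differentiating and integrating the two problems. -/

section

/-- The predicates fed to the choice operator are equal, so the chosen functions are literally the
same; thus `𝒲` receives the same argument. -/
lemma contRep_congr {V : Type*} [NormedAddCommGroup V] [NormedSpace ℂ V] {T : ℝ} {w w' : ℝ → V}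
    (h : w =ᵐ[timeMeasure T] w') : contRep T w = contRep T w' := by
  have hp : (fun F : ℝ → V => ContinuousOn F (Icc 0 T) ∧ F =ᵐ[timeMeasure T] w)
      = fun F => ContinuousOn F (Icc 0 T) ∧ F =ᵐ[timeMeasure T] w' :=
    funext fun F => propext ⟨fun H => ⟨H.1, H.2.trans h⟩, fun H => ⟨H.1, H.2.trans h.symm⟩⟩
  classical
  exact congrArg (fun p : (ℝ → V) → Prop => if h : ∃ F, p F then h.choose else 0) hp

namespace Data

variable {n : ℕ} {P : Data n}

lemma feedback_congr {u u' : ℝ → H2 P.Ω} (h : u =ᵐ[timeMeasure P.T] u') :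
    P.feedback u = P.feedback u' := by
  unfold feedback
  rw [contRep_congr (w' := fun t => P.M (u' t))]
  filter_upwards [h] with t ht
  rw [ht]

lemma hasTimePrim_E1 (P : Data n) :
    HasTimePrim P.T P.E1 (P.ε : ℂ)⁻¹
      (fun t => ((P.ε⁻¹ * (Real.exp (-t / P.ε) * (-1 / P.ε)) : ℝ) : ℂ)) := by
  have h0 : P.E1 0 = (P.ε : ℂ)⁻¹ := by simp [E1]
  rw [← h0]
  refine HasTimePrim.of_continuous_deriv (fun t => ?_) ?_
  · have h1 : HasDerivAt (fun t : ℝ => -t / P.ε) (-1 / P.ε) t := (hasDerivAt_id t).neg.div_const _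
    exact (h1.exp.const_mul P.ε⁻¹).ofReal_comp
  · fun_prop

/-- The feedback term lies in `H¹(0, T; L²(Γ))`, and its initial value does not depend on the
memory operator. -/
lemma Admissible.hasTimePrim_feedback (hP : P.Admissible) {u v : ℝ → H2 P.Ω} {c : H2 P.Ω}
    (hu : HasTimePrim P.T u c v) :
    ∃ F', HasTimePrim P.T (P.feedback u)
      (P.φ₀ • initialValue P.T P.uA + initialValue P.T P.uB) F' := by
  have hT := hP.T_pos
  have hM : HasTimePrim P.T (fun t => P.M (u t)) (P.M c) (fun t => P.M (v t)) := by
    have := hu.map hT P.ML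
    simpa only [ML_apply] using this
  -- The measurement is absolutely continuous in time, hence of bounded variation and in the domain
  -- of `𝒲`.
  have hr0 : MemCBV P.T (contRep P.T fun t => P.M (u t)) := by
    have he := hM.contRep_eq hT
    have hac := absolutelyContinuous_const_add (P.M c)
      (absolutelyContinuous_primitive (hM.1.intervalIntegrable hT))
    refine ⟨(continuousOn_primitive_add hT hM.1 _).congr he, ?_⟩
    have hbv := hac.boundedVariationOn
    rw [uIcc_of_le hT.le] at hbv
    unfold BoundedVariationOn at hbv ⊢
    rwa [eVariationOn.congr he]
  have hr := hP.W_maps P.T (right_mem_Icc.2 hT.le) _ hr0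
  set r := P.W P.T (contRep P.T fun t => P.M (u t)) with hrdef
  have hconv : ∀ k : ℝ → ℂ, MemCBV P.T k → ∃ k', HasTimePrim P.T (conv P.E1 k) 0 k' := by
    intro k hk
    have h1 := P.hasTimePrim_E1.conv hT (memTimeL2_of_continuousOn hk.1)
    -- By commutativity the derivative falls on the smooth kernel `E₁`, and `k` needs only to be
    -- continuous.
    refine ⟨_, h1.congr (Filter.Eventually.of_forall fun t => conv_comm _ _ _)⟩
  obtain ⟨k₁, hk₁⟩ := hconv r hr
  obtain ⟨k₂, hk₂⟩ := hconv P.uC hP.uC_mem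
  have hA := hP.uA_mem.1.1.hasTimePrim hT
  have hB := hP.uB_mem.1.1.hasTimePrim hT
  have hE := P.hasTimePrim_E1.map hT (((P.ε : ℂ) * P.φ₀) • ContinuousLinearMap.id ℂ ℂ)
  have h0 := (((hk₁.smul hT hA).add hT (((hk₂.add hT hE).smul hT hA).add hT hB)))
  have hε : (P.ε : ℂ) ≠ 0 := by exact_mod_cast hP.ε_pos.ne'
  -- Both convolutions vanish at `0`, and `E₁(0) = ε⁻¹`, so the coefficient of `u_A` starts at `φ₀`.
  have hφ : (P.ε : ℂ) * P.φ₀ * (P.ε : ℂ)⁻¹ = P.φ₀ := by field_simp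
  simp only [zero_smul, zero_add, smul_apply, ContinuousLinearMap.id_apply, smul_eq_mul, hφ] at h0
  exact ⟨_, h0⟩

lemma memPair_eq (hP : P.Admissible) (v : ℝ → H2 P.Ω) (h : ℝ → ℂ) (t : ℝ) :
    P.memPair v h t = P.χ * (P.Phi (P.A (v t)) + conv h (fun s => P.Phi (P.A (v s))) t) := by
  unfold memPair conv
  simp only [hP.pair_eq, smul_eq_mul, mul_left_comm _ P.χ, intervalIntegral.integral_const_mul]
  ring

/-- The equation for the convolution kernel, multiplied by `Φ(A u₀)`. -/
lemma kernel_iff (hP : P.Admissible) (v : ℝ → H2 P.Ω) (h : ℝ → ℂ) (t : ℝ) :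
    h t = P.hstar t - P.memPair v h t ↔
      timeDeriv P.T (timeDeriv P.T P.g) t = P.Phi (P.A (v t))
        + (h t * P.Phi (P.A P.u₀) + conv h (fun s => P.Phi (P.A (v s))) t)
        + P.Phi (timeDeriv P.T P.f t) := by
  have hne := hP.Phi_ne
  rw [memPair_eq hP, hstar, χ]
  constructor
  · intro h1
    have h2 := congrArg (· * P.Phi (P.A P.u₀)) h1
    field_simp at h2
    linear_combination -h2
  · intro h1
    rw [h1]
    field_simp
    ring

/-- The right-hand side of the parabolic equation. -/
lemma hasTimePrim_rhs (hP : P.Admissible) {u v : ℝ → H2 P.Ω} {h : ℝ → ℂ}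
    (hh : MemTimeL2 P.T h) (hu : HasTimePrim P.T u P.u₀ v) :
    HasTimePrim P.T (fun t => P.A (u t) + conv h (fun s => P.A (u s)) t + P.f t) P.v₀
      (fun t => P.A (v t) + (h t • P.A P.u₀ + conv h (fun s => P.A (v s)) t)
        + timeDeriv P.T P.f t) := by
  have hT := hP.T_pos
  obtain ⟨L, hL⟩ := hP.exists_A
  simp only [v₀, hL]
  have h1 := hu.map hT L
  have h2 := (h1.add hT (h1.conv hT hh)).add hT (hP.f_mem.hasTimePrim hT)
  rwa [add_zero] at h2

/-- The left-hand side of the boundary condition. -/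
lemma hasTimePrim_bdry (hP : P.Admissible) {u v : ℝ → H2 P.Ω} {h : ℝ → ℂ}
    (hh : MemTimeL2 P.T h) (hu : HasTimePrim P.T u P.u₀ v) :
    HasTimePrim P.T (fun t => P.B (u t) + conv h (fun s => P.B (u s)) t + P.q t + P.tr (u t))
      (P.φ₀ • initialValue P.T P.uA + initialValue P.T P.uB)
      (fun t => P.B (v t) + (h t • P.B P.u₀ + conv h (fun s => P.B (v s)) t)
        + timeDeriv P.T P.q t + P.tr (v t)) := by
  have hT := hP.T_pos
  -- The boundary compatibility condition puts the initial value in the form shared with the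
  -- feedback.
  have hc : P.φ₀ • initialValue P.T P.uA + initialValue P.T P.uB
      = P.B P.u₀ + 0 + initialValue P.T P.q + P.tr P.u₀ := by
    rw [add_zero, hP.compat_bdry]
    abel
  obtain ⟨L, hL⟩ := hP.exists_B
  rw [hc]
  simp only [hL, ← trL_apply]
  have h1 := hu.map hT L
  exact ((h1.add hT (h1.conv hT hh)).add hT (hP.q_mem.1.1.hasTimePrim hT)).add hT
    (hu.map hT P.trL)

/-- `Φ` of the time derivative of the right-hand side of the parabolic equation. -/
lemma Phi_deriv_rhs (hP : P.Admissible) {v : ℝ → H2 P.Ω} {h : ℝ → ℂ}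
    (hh : MemTimeL2 P.T h) (hv : MemTimeL2 P.T v) {t : ℝ} (ht : t ∈ Icc 0 P.T) :
    P.Phi (P.A (v t) + (h t • P.A P.u₀ + conv h (fun s => P.A (v s)) t) + timeDeriv P.T P.f t)
      = P.Phi (P.A (v t)) + (h t * P.Phi (P.A P.u₀) + conv h (fun s => P.Phi (P.A (v s))) t)
        + P.Phi (timeDeriv P.T P.f t) := by
  obtain ⟨L, hL⟩ := hP.exists_A
  simp only [hL]
  have hLv : MemTimeL2 P.T (fun s => L (v s)) := L.comp_memLp' hv
  simp only [← PhiL_apply, map_add, map_smul, smul_eq_mul, map_conv P.PhiL hh hLv ht]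

theorem solves3_of_solves2 (hP : P.Admissible) {u : ℝ → H2 P.Ω} {h : ℝ → ℂ}
    (hr : P.Regular2 u h) (hs : P.Solves2 u h) :
    P.Regular3 (timeDeriv P.T u) h ∧ P.Solves3 (timeDeriv P.T u) h := by
  have hT := hP.T_pos
  obtain ⟨-, hu, hh⟩ := hr
  set v := timeDeriv P.T u with hv
  have hU : HasTimePrim P.T u (initialValue P.T u) v := hu.hasTimePrim hT
  have h0 : initialValue P.T u = P.u₀ := H2.fn_injective hP.domain.1
    (((hU.map hT (H2.fnL P.Ω)).initialValue_eq hT).symm.trans hs.init)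
  rw [h0] at hU
  have hUf : HasTimePrim P.T (fun t => (u t).fn) P.u₀.fn (fun t => (v t).fn) :=
    hU.map hT (H2.fnL P.Ω)
  have hK := hasTimePrim_rhs hP hh hU
  -- The evolution equation identifies `v` with its right-hand side, whose normal form gives at once
  -- `v(0) = v₀` and `D_t v`.
  have hV : HasTimePrim P.T (fun t => (v t).fn) P.v₀ _ :=
    hK.congr ((hUf.timeDeriv_ae_eq hT).symm.trans hs.eq)
  have hg1 : timeDeriv P.T P.g =ᵐ[timeMeasure P.T] fun t => P.PhiL (v t).fn := by
    refine ((hUf.map hT P.PhiL).congr ?_).timeDeriv_ae_eq hT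
    filter_upwards [hs.meas] with t ht
    rw [PhiL_apply, ht]
  have hg2 := ((hV.map hT P.PhiL).congr hg1).timeDeriv_ae_eq hT
  have hker : ∀ᵐ t ∂(timeMeasure P.T), h t = P.hstar t - P.memPair v h t := by
    filter_upwards [hg2, ae_timeMeasure_mem P.T] with t h1 ht
    rw [kernel_iff hP, h1, PhiL_apply, Phi_deriv_rhs hP hh hU.1 (Ioo_subset_Icc_self ht)]
  refine ⟨⟨⟨hV.memTimeH1 hT, hU.1⟩, hh⟩, ?_, hV.initialValue_eq hT, ?_, hker⟩
  · filter_upwards [hV.timeDeriv_ae_eq hT, hker] with t h1 h2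
    -- The kernel equation splits the term created by differentiating the convolution into the
    -- source in `v*` and the `z₀` term.
    have h3 : h t • P.A P.u₀ = P.hstar t • P.A P.u₀ - P.memPair v h t • P.A P.u₀ := by
      rw [← sub_smul, ← h2]
    rw [h1, h3, vstar, z₀]
    abel
  -- Integrating `v` recovers `u`, so `Ψ(v)` is the derivative of the feedback of `u`, which the
  -- boundary condition equates with an explicitly differentiable expression.
  · have hprim : P.primitive v =ᵐ[timeMeasure P.T] u := by
      refine Filter.EventuallyEq.trans (Filter.Eventually.of_forall fun t => ?_) hU.2.symm
      simp only [primitive, conv, one_smul]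
    have hF : P.feedback (P.primitive v) =ᵐ[timeMeasure P.T]
        fun t => P.B (u t) + conv h (fun s => P.B (u s)) t + P.q t + P.tr (u t) := by
      rw [feedback_congr hprim]
      filter_upwards [hs.bdry] with t ht
      rw [ht, sub_add_cancel]
    filter_upwards [((hasTimePrim_bdry hP hh hU).congr hF).timeDeriv_ae_eq hT, hker] with t h1 h2
    have h3 : h t • P.B P.u₀ = P.hstar t • P.B P.u₀ - P.memPair v h t • P.B P.u₀ := by
      rw [← sub_smul, ← h2]
    rw [Psi, h1, h3, vstarΓ, z₁]
    abel

theorem solves2_of_solves3 (hP : P.Admissible) {v : ℝ → H2 P.Ω} {h : ℝ → ℂ}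
    (hr : P.Regular3 v h) (hs : P.Solves3 v h) :
    P.Regular2 (P.primitive v) h ∧ P.Solves2 (P.primitive v) h := by
  have hT := hP.T_pos
  obtain ⟨⟨hvf, hvL⟩, hh⟩ := hr
  set u := P.primitive v with hu
  have hU : HasTimePrim P.T u P.u₀ v := by
    refine ⟨hvL, Filter.Eventually.of_forall fun t => ?_⟩
    simp only [hu, primitive, conv, one_smul]
  have hUf : HasTimePrim P.T (fun t => (u t).fn) P.u₀.fn (fun t => (v t).fn) :=
    hU.map hT (H2.fnL P.Ω)
  have hV := hvf.hasTimePrim hT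
  rw [hs.init] at hV
  have hd : timeDeriv P.T (fun t => (v t).fn) =ᵐ[timeMeasure P.T]
      fun t => P.A (v t) + (h t • P.A P.u₀ + conv h (fun s => P.A (v s)) t)
        + timeDeriv P.T P.f t := by
    filter_upwards [hs.eq, hs.kernel] with t h1 h2
    have h3 : h t • P.A P.u₀ = P.hstar t • P.A P.u₀ - P.memPair v h t • P.A P.u₀ := by
      rw [← sub_smul, ← h2]
    rw [h1, h3, vstar, z₀]
    abel
  have hdu := hUf.timeDeriv_ae_eq hT
  refine ⟨⟨⟨hUf.memTimeH1 hT, (hV.congr hdu).memTimeH1 hT⟩, hU.memTimeH1 hT, hh⟩, ?_, ?_,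
    hUf.initialValue_eq hT, ?_⟩
  -- `v` and the right-hand side of the evolution equation start at `v₀` and have the same
  -- derivative.
  · exact hdu.trans (hV.unique (hasTimePrim_rhs hP hh hU) hd)
  · obtain ⟨F', hF⟩ := hP.hasTimePrim_feedback hU
    -- The differentiated boundary condition, with the kernel equation, matches the derivative of
    -- the feedback with that of the boundary expression; their initial values already agree.
    have hF' : F' =ᵐ[timeMeasure P.T] fun t => P.B (v t)
        + (h t • P.B P.u₀ + conv h (fun s => P.B (v s)) t)
        + timeDeriv P.T P.q t + P.tr (v t) := by
      filter_upwards [hF.timeDeriv_ae_eq hT, hs.bdry, hs.kernel] with t h1 h2 h4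
      have h3 : h t • P.B P.u₀ = P.hstar t • P.B P.u₀ - P.memPair v h t • P.B P.u₀ := by
        rw [← sub_smul, ← h4]
      rw [Psi, h1] at h2
      rw [h3, h2, vstarΓ, z₁]
      abel
    filter_upwards [hF.unique (hasTimePrim_bdry hP hh hU) hF'] with t ht
    rw [ht]
    abel
  · have hG := hP.g_mem.1.hasTimePrim hT
    have hG' := hP.g_mem.2.hasTimePrim hT
    rw [← hP.compat_g] at hG
    rw [← hP.compat_g'] at hG'
    -- The kernel equation says `D_t Φ(v) = g''`. Two integrations, with constants fixed by `Φ(v₀) =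
    -- g'(0)` and `Φ(u₀) = g(0)`, give `Φ(u) = g`.
    have e1 : (fun t => P.PhiL (v t).fn) =ᵐ[timeMeasure P.T] timeDeriv P.T P.g := by
      refine HasTimePrim.unique ((hV.congr_deriv hd).map hT P.PhiL)
        (c := P.PhiL P.v₀) (by rwa [PhiL_apply]) ?_
      filter_upwards [hs.kernel, ae_timeMeasure_mem P.T] with t h1 ht
      rw [PhiL_apply, Phi_deriv_rhs hP hh hvL (Ioo_subset_Icc_self ht), (kernel_iff hP v h t).1 h1]
    have e2 : (fun t => P.PhiL (u t).fn) =ᵐ[timeMeasure P.T] P.g :=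
      HasTimePrim.unique (hUf.map hT P.PhiL) (c := P.PhiL P.u₀.fn) (by rwa [PhiL_apply]) e1
    filter_upwards [e2] with t ht
    rw [← PhiL_apply, ht]

end Data

end

end InverseControl

end

theorem proposition2p1 {n : ℕ} (hn : 1 ≤ n) (P : InverseControl.Data n) (hP : P.Admissible) :
    (∀ (u : ℝ → InverseControl.H2 P.Ω) (h : ℝ → ℂ), P.Regular2 u h → P.Solves2 u h →
      P.Regular3 (InverseControl.timeDeriv P.T u) h ∧
        P.Solves3 (InverseControl.timeDeriv P.T u) h) ∧
    (∀ (v : ℝ → InverseControl.H2 P.Ω) (h : ℝ → ℂ), P.Regular3 v h → P.Solves3 v h →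
      P.Regular2 (P.primitive v) h ∧ P.Solves2 (P.primitive v) h) :=
  ⟨fun _ _ hr hs => InverseControl.Data.solves3_of_solves2 hP hr hs,
    fun _ _ hr hs => InverseControl.Data.solves2_of_solves3 hP hr hs⟩
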